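/- Let $n\ge 2$. An interval exchange transformation $\varphi=\varphi(\lambda,\pi,\varepsilon)$ of $n$ intervals (flips allowed) is given by positive lengths $\lambda_1,\dots,\lambda_n$ with $\lambda_1+\dots+\lambda_n=1$, a permutation $\pi$ of $\{1,\dots,n\}$ and signs $\varepsilon_i=\pm1$. Put $\beta_0=0$, $\beta_i=\lambda_1+\dots+\lambda_i$, $v_i=[\beta_{i-1},\beta_i)$ and $\gamma_i=\sum_{k<\pi(i)}\lambda_{\pi^{-1}(k)}$; for $x\in v_i$ put $\varphi(x)=x-\beta_{i-1}+\gamma_i$ if $\varepsilon_i=1$ and $\varphi(x)=\beta_i-x+\gamma_i$ if $\varepsilon_i=-1$. A Borel probability measure $\mu$ on $[0,1)$ is invariant if $\mu(\varphi^{-1}(A))=\mu(A)$ for all Borel sets $A$ and, in case some $\varepsilon_i=-1$ (so that $\varphi$ is a bijection only off the finite set of endpoints), $\mu(\{\beta_i\})=0$ for $0\le i<n$. The transformation $\varphi$ is called strictly (uniquely) ergodic if it has exactly one invariant Borel probability measure. Let $\mathcal O_\lambda$ be the unital $C^*$-algebra of operators on $L^2([0,1])$ generated by the unitary $u(\zeta)=\zeta\circ\varphi^{-1}$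 and by the operators of multiplication by the characteristic functions $\chi_{v_1},\dots,\chi_{v_n}$. Let $(K_0,K_0^+,[1])$ be its $K_0$-group (the Grothendieck group of the semigroup of Murray-von Neumann classes of projections in matrix algebras over $\mathcal O_\lambda$), with the positive cone formed by the classes of projections and with the class of the unit as order unit. A Bratteli diagram of $\varphi$ is a sequence $P_1,P_2,P_3,\dots$ of $n\times n$ matrices with non-negative integer entries, together with a vector $d\in\mathbb Z_{\ge0}^n$, such that $(K_0,K_0^+,[1])$ is isomorphic, as an ordered group with order unit, to the inductive limit of $$\mathbb Z^n\xrightarrow{P_1}\mathbb Z^n\xrightarrow{P_2}\mathbb Z^n\xrightarrow{P_3}\cdots,$$ where $\mathbb Z^n$ is ordered coordinatewise, the matrices act on row vectors, and the order unit is the image of the vector $d$ at the first level. The transformation $\varphi$ is called stationary if it has a Bratteli diagram whose sequence of matrices can be divided into consecutive finite non-empty blocks $P_m,P_{m+1},\dots,P_{m+k}$ whose products $P_mP_{m+1}\cdots P_{m+k}$ are all equal to one and the same matrix $P$ with strictly positive entries. Theorem. Every stationary interval exchange transformation of $n\ge2$ intervals is strictly (uniquely) ergodic. -/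

import Mathlib

open MeasureTheory

/-! ### Interval exchange transformations -/

/-- Data `(λ, π, ε)` of an interval exchange transformation of `n` intervals (with flips):
positive lengths of total sum one, a permutation, and a vector of signs. -/
structure IntervalExchange (n : ℕ) where
  len : Fin n → ℝ
  len_pos : ∀ i, 0 < len i
  sum_len : ∑ i, len i = 1
  perm : Equiv.Perm (Fin n)
  sign : Fin n → ℤˣ

namespace IntervalExchange

/-- The left endpoint of the `i`-th interval when intervals of lengths `l 0, l 1, …` are laid
side by side from left to right, starting at `0`. -/
noncomputable def start {n : ℕ} (l : Fin n → ℝ) (i : Fin n) : ℝ :=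
  ∑ j ∈ Finset.Iio i, l j

/-- The left endpoint of the `i`-th interval. -/
noncomputable def left {n : ℕ} (T : IntervalExchange n) (i : Fin n) : ℝ :=
  start T.len i

/-- The left endpoint of the image of the `i`-th interval, which is put at place `π i`. -/
noncomputable def imageLeft {n : ℕ} (T : IntervalExchange n) (i : Fin n) : ℝ :=
  start (fun k => T.len (T.perm.symm k)) (T.perm i)

/-- The `i`-th interval of the partition of `[0, 1)`. -/
def interval {n : ℕ} (T : IntervalExchange n) (i : Fin n) : Set ℝ :=
  Set.Ico (T.left i) (T.left i + T.len i)

/-- The isometry by which the `i`-th interval is moved: a translation if `ε i = 1`,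
a reflection if `ε i = -1`. -/
noncomputable def piece {n : ℕ} (T : IntervalExchange n) (i : Fin n) (x : ℝ) : ℝ :=
  if T.sign i = 1 then x - T.left i + T.imageLeft i
  else T.left i + T.len i - x + T.imageLeft i

open Classical in
/-- The transformation `φ`. It is the `i`-th isometry on the `i`-th interval; it matters on
`[0, 1)` only, and is given the value `0` elsewhere. -/
noncomputable def toFun {n : ℕ} (T : IntervalExchange n) (x : ℝ) : ℝ :=
  ∑ i, if x ∈ T.interval i then T.piece i x else 0

/-- The unit interval `[0, 1)` with Lebesgue measure. -/
noncomputable def lebesgue : Measure ℝ := volume.restrict (Set.Ico 0 1)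

/-! #### Lebesgue measure is invariant -/

theorem start_tiling {n : ℕ} (l : Fin n → ℝ) (hl : ∀ i, 0 < l i) :
    (⋃ i, Set.Ico (start l i) (start l i + l i)) = Set.Ico 0 (∑ i, l i) ∧
      Pairwise (fun i j => Disjoint (Set.Ico (start l i) (start l i + l i))
        (Set.Ico (start l j) (start l j + l j))) := by
  induction n with
  | zero =>
    refine ⟨by simp, fun i => i.elim0⟩
  | succ n ih =>
    obtain ⟨h1, h2⟩ := ih (fun i => l i.castSucc) (fun i => hl _)
    have hs : ∀ i : Fin n, start l i.castSucc = start (fun i => l i.castSucc) i := by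
      intro i
      simp [start, ← Fin.map_castSuccEmb_Iio, Finset.sum_map]
    have hlast : start l (Fin.last n) = ∑ i : Fin n, l i.castSucc := by
      have : Finset.Iio (Fin.last n) = Finset.univ.map Fin.castSuccEmb := by
        ext j
        constructor
        · intro hj
          simp only [Finset.mem_Iio] at hj
          exact Finset.mem_map.2 ⟨j.castPred hj.ne, by simp, by simp⟩
        · simp only [Finset.mem_map, Finset.mem_Iio]
          rintro ⟨i, -, rfl⟩
          exact Fin.castSucc_lt_last i
      rw [start, this, Finset.sum_map]
      rfl
    have hnn : (0 : ℝ) ≤ ∑ i : Fin n, l i.castSucc := Finset.sum_nonneg fun i _ => (hl _).le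
    have hdl : ∀ i : Fin n, Disjoint (Set.Ico (start l i.castSucc)
        (start l i.castSucc + l i.castSucc))
        (Set.Ico (start l (Fin.last n)) (start l (Fin.last n) + l (Fin.last n))) := by
      intro i
      rw [hlast, Set.disjoint_left]
      intro x hx hx'
      rw [hs] at hx
      have : x ∈ Set.Ico (0 : ℝ) (∑ i : Fin n, l i.castSucc) := by
        rw [← h1]
        exact Set.mem_iUnion.2 ⟨i, hx⟩
      exact absurd this.2 (not_lt.2 hx'.1)
    constructor
    · have key : (⋃ i : Fin (n + 1), Set.Ico (start l i) (start l i + l i)) =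
          (⋃ i : Fin n, Set.Ico (start l i.castSucc) (start l i.castSucc + l i.castSucc)) ∪
            Set.Ico (start l (Fin.last n)) (start l (Fin.last n) + l (Fin.last n)) := by
        ext x
        simp only [Set.mem_iUnion, Set.mem_union, Fin.exists_fin_succ']
      rw [key, Fin.sum_univ_castSucc, hlast]
      simp only [hs]
      rw [h1, Set.Ico_union_Ico_eq_Ico hnn]
      linarith [hl (Fin.last n)]
    · intro i j hij
      induction i using Fin.lastCases with
      | last =>
        induction j using Fin.lastCases with
        | last => exact absurd rfl hij
        | cast j => exact (hdl j).symm
      | cast i =>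
        induction j using Fin.lastCases with
        | last => exact hdl i
        | cast j =>
          simp only [hs]
          exact h2 fun h => hij (by rw [h])

theorem restrict_tiling {n : ℕ} (l : Fin n → ℝ) (hl : ∀ i, 0 < l i) (h1 : ∑ i, l i = 1) :
    lebesgue = Measure.sum fun i =>
      (volume : Measure ℝ).restrict (Set.Ico (start l i) (start l i + l i)) := by
  obtain ⟨h, h'⟩ := start_tiling l hl
  rw [lebesgue, ← h1, ← h, Measure.restrict_iUnion h' fun i => measurableSet_Ico]

theorem toFun_eq {n : ℕ} (T : IntervalExchange n) (i : Fin n) {x : ℝ} (hx : x ∈ T.interval i) :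
    T.toFun x = T.piece i x := by
  rw [toFun, Finset.sum_eq_single i]
  · rw [if_pos hx]
  · intro j _ hj
    rw [if_neg]
    intro hxj
    exact Set.disjoint_left.1 ((start_tiling T.len T.len_pos).2 hj) hxj hx
  · intro h
    exact absurd (Finset.mem_univ i) h

theorem measurable_piece {n : ℕ} (T : IntervalExchange n) (i : Fin n) :
    Measurable (T.piece i) := by
  unfold piece
  split_ifs <;> fun_prop

theorem measurable_toFun {n : ℕ} (T : IntervalExchange n) : Measurable T.toFun :=
  Finset.measurable_fun_sum _ fun i _ =>
    Measurable.ite measurableSet_Ico (T.measurable_piece i) measurable_const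

theorem map_piece {n : ℕ} (T : IntervalExchange n) (i : Fin n) :
    ((volume : Measure ℝ).restrict (T.interval i)).map (T.piece i) =
      (volume : Measure ℝ).restrict (Set.Ico (T.imageLeft i) (T.imageLeft i + T.len i)) := by
  by_cases h : T.sign i = 1
  · have hp : T.piece i = fun x => x + (T.imageLeft i - T.left i) := by
      funext x
      rw [piece, if_pos h]
      ring
    have hm : MeasurePreserving (T.piece i) volume volume := by
      rw [hp]
      exact measurePreserving_add_right volume _
    have hpre : T.piece i ⁻¹' (Set.Ico (T.imageLeft i) (T.imageLeft i + T.len i)) =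
        T.interval i := by
      ext x
      simp only [hp, interval, Set.mem_preimage, Set.mem_Ico]
      constructor <;> rintro ⟨_, _⟩ <;> constructor <;> linarith
    rw [← hpre]
    exact (hm.restrict_preimage measurableSet_Ico).map_eq
  · have hp : T.piece i = fun x => (T.left i + T.len i + T.imageLeft i) - x := by
      funext x
      rw [piece, if_neg h]
      ring
    have hm : MeasurePreserving (T.piece i) volume volume := by
      rw [hp]
      exact Measure.measurePreserving_sub_left volume _
    have hpre : T.piece i ⁻¹' (Set.Ioc (T.imageLeft i) (T.imageLeft i + T.len i)) =
        T.interval i := by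
      ext x
      simp only [hp, interval, Set.mem_preimage, Set.mem_Ico, Set.mem_Ioc]
      constructor <;> rintro ⟨_, _⟩ <;> constructor <;> linarith
    rw [← hpre, Measure.restrict_congr_set Ico_ae_eq_Ioc]
    exact (hm.restrict_preimage measurableSet_Ioc).map_eq

/-- An interval exchange transformation preserves Lebesgue measure on `[0, 1)`. -/
theorem measurePreserving {n : ℕ} (T : IntervalExchange n) :
    MeasurePreserving T.toFun lebesgue lebesgue := by
  refine ⟨T.measurable_toFun, ?_⟩
  have e1 : lebesgue = Measure.sum fun i => (volume : Measure ℝ).restrict (T.interval i) :=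
    restrict_tiling T.len T.len_pos T.sum_len
  have e2 : lebesgue = Measure.sum fun i =>
      (volume : Measure ℝ).restrict (Set.Ico (T.imageLeft i) (T.imageLeft i + T.len i)) := by
    rw [restrict_tiling (fun k => T.len (T.perm.symm k)) (fun i => T.len_pos _)
      (by rw [← T.sum_len]; exact Equiv.sum_comp T.perm.symm T.len)]
    rw [← Measure.sum_comp_equiv T.perm]
    simp [imageLeft]
  conv_lhs => rw [e1]
  rw [Measure.map_sum T.measurable_toFun.aemeasurable, e2]
  congr 1
  funext i
  rw [← T.map_piece i]
  refine Measure.map_congr ?_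
  filter_upwards [ae_restrict_mem (measurableSet_Ico :
    MeasurableSet (Set.Ico (T.left i) (T.left i + T.len i)))] with x hx
  exact T.toFun_eq i hx

/-! #### Invariant measures and strict ergodicity -/

/-- Invariance of a measure on `[0, 1)`. If some interval is flipped, `φ` is a bijection only
off the finite set of endpoints of the intervals, where the choice of its values is a mere
convention; then the invariant measures are those that do not charge this set. -/
structure IsInvariant {n : ℕ} (T : IntervalExchange n) (μ : Measure ℝ) : Prop where
  carrier : μ (Set.Ico 0 1)ᶜ = 0
  preserving : MeasurePreserving T.toFun μ μ
  endpoints : (∃ i, T.sign i = -1) → ∀ i, μ {T.left i} = 0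

/-- Strict (unique) ergodicity: there is exactly one invariant Borel probability measure. -/
def StrictlyErgodic {n : ℕ} (T : IntervalExchange n) : Prop :=
  ∃! μ : Measure ℝ, IsProbabilityMeasure μ ∧ T.IsInvariant μ

/-! #### The C*-algebra of an interval exchange transformation -/

/-- The Hilbert space `L²([0, 1])`. -/
abbrev Hilbert : Type := Lp ℂ 2 lebesgue

/-- The isometry `ζ ↦ ζ ∘ φ` of `L²([0, 1])`. -/
noncomputable def koopman {n : ℕ} (T : IntervalExchange n) : Hilbert →L[ℂ] Hilbert :=
  (Lp.compMeasurePreservingₗᵢ ℂ T.toFun T.measurePreserving).toContinuousLinearMap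

/-- The unitary operator `u(ζ) = ζ ∘ φ⁻¹`, that is, the inverse (equivalently, the adjoint) of
the unitary operator `ζ ↦ ζ ∘ φ`. -/
noncomputable def unitaryOp {n : ℕ} (T : IntervalExchange n) : Hilbert →L[ℂ] Hilbert :=
  ContinuousLinearMap.adjoint T.koopman

theorem unitaryOp_comp {n : ℕ} (T : IntervalExchange n) (ζ : Hilbert) :
    T.unitaryOp (Lp.compMeasurePreserving T.toFun T.measurePreserving ζ) = ζ := by
  have h : (ContinuousLinearMap.adjoint T.koopman) ∘L T.koopman = ContinuousLinearMap.id ℂ _ :=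
    (ContinuousLinearMap.norm_map_iff_adjoint_comp_self T.koopman).1
      (Lp.norm_compMeasurePreserving · T.measurePreserving)
  exact congrArg (fun S : Hilbert →L[ℂ] Hilbert => S ζ) h

/-- The operator of multiplication by the characteristic function of the `i`-th interval. -/
noncomputable def charOp {n : ℕ} (T : IntervalExchange n) (i : Fin n) : Hilbert →L[ℂ] Hilbert :=
  (ContinuousLinearMap.mul ℂ ℂ).holderL lebesgue ⊤ 2 2
    (indicatorConstLp ⊤ (measurableSet_Ico : MeasurableSet (T.interval i))
      (measure_ne_top_of_subset (Set.subset_univ _) (by simp [lebesgue])) 1)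

theorem charOp_apply {n : ℕ} (T : IntervalExchange n) (i : Fin n) (ζ : Hilbert) :
    T.charOp i ζ =ᵐ[lebesgue] (T.interval i).indicator ζ := by
  refine (ContinuousLinearMap.coeFn_holder (r := 2) (ContinuousLinearMap.mul ℂ ℂ) _ ζ).trans ?_
  filter_upwards [indicatorConstLp_coeFn (p := ⊤) (μ := lebesgue) (c := (1 : ℂ))
    (hs := (measurableSet_Ico : MeasurableSet (T.interval i)))
    (hμs := measure_ne_top_of_subset (Set.subset_univ _) (by simp [lebesgue]))] with x hx
  rw [hx]
  change (T.interval i).indicator (fun _ => (1 : ℂ)) x * ζ x = _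
  by_cases h : x ∈ T.interval i <;> simp [h]

/-- The C*-algebra of `T`: the norm closed unital `*`-algebra of operators on `L²([0, 1])`
generated by `u` and the characteristic operators of the intervals. -/
noncomputable def cstarAlgebra {n : ℕ} (T : IntervalExchange n) :
    StarSubalgebra ℂ (Hilbert →L[ℂ] Hilbert) :=
  (StarAlgebra.adjoin ℂ (insert T.unitaryOp (Set.range T.charOp))).topologicalClosure

end IntervalExchange

/-! ### The group `K₀` -/

/-- A projection in some matrix algebra over `A`. -/
structure MatrixProjection (A : Type*) [Ring A] [StarRing A] where
  size : ℕ
  mat : Matrix (Fin size) (Fin size) A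
  isProj : IsStarProjection mat

namespace MatrixProjection

variable {A : Type*} [Ring A] [StarRing A]

open Matrix

/-- Murray–von Neumann equivalence of projections: `p = v v*` and `q = v* v` for some (possibly
rectangular) matrix `v`. -/
def Equivalent (p q : MatrixProjection A) : Prop :=
  ∃ v : Matrix (Fin p.size) (Fin q.size) A, v * vᴴ = p.mat ∧ vᴴ * v = q.mat

theorem Equivalent.refl (p : MatrixProjection A) : Equivalent p p := by
  have h1 : p.matᴴ = p.mat := p.isProj.isSelfAdjoint
  have h2 : p.mat * p.mat = p.mat := p.isProj.isIdempotentElem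
  exact ⟨p.mat, by rw [h1, h2], by rw [h1, h2]⟩

theorem Equivalent.symm {p q : MatrixProjection A} (h : Equivalent p q) : Equivalent q p := by
  obtain ⟨v, h1, h2⟩ := h
  exact ⟨vᴴ, by rw [conjTranspose_conjTranspose, h2], by rw [conjTranspose_conjTranspose, h1]⟩

theorem Equivalent.trans {p q r : MatrixProjection A} (h : Equivalent p q)
    (h' : Equivalent q r) : Equivalent p r := by
  obtain ⟨v, h1, h2⟩ := h
  obtain ⟨w, h3, h4⟩ := h'
  have hp : p.mat * p.mat = p.mat := p.isProj.isIdempotentElem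
  have hr : r.mat * r.mat = r.mat := r.isProj.isIdempotentElem
  refine ⟨v * w, ?_, ?_⟩
  · calc v * w * (v * w)ᴴ = v * (w * wᴴ) * vᴴ := by
          simp only [conjTranspose_mul, Matrix.mul_assoc]
      _ = (v * vᴴ) * (v * vᴴ) := by rw [h3, ← h2]; simp only [Matrix.mul_assoc]
      _ = p.mat := by rw [h1, hp]
  · calc (v * w)ᴴ * (v * w) = wᴴ * (vᴴ * v) * w := by
          simp only [conjTranspose_mul, Matrix.mul_assoc]
      _ = (wᴴ * w) * (wᴴ * w) := by rw [h2, ← h3]; simp only [Matrix.mul_assoc]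
      _ = r.mat := by rw [h4, hr]

instance setoid (A : Type*) [Ring A] [StarRing A] : Setoid (MatrixProjection A) where
  r := Equivalent
  iseqv := ⟨Equivalent.refl, Equivalent.symm, Equivalent.trans⟩

/-- A projection matrix over an arbitrary finite index type, as a projection. -/
def ofIndex {k : ℕ} {ι : Type*} [Fintype ι] (e : ι ≃ Fin k) (p : Matrix ι ι A)
    (hp : IsStarProjection p) : MatrixProjection A where
  size := k
  mat := p.submatrix e.symm e.symm
  isProj := by
    have h1 : pᴴ = p := hp.isSelfAdjoint
    have h2 : p * p = p := hp.isIdempotentElem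
    refine ⟨?_, ?_⟩
    · rw [IsIdempotentElem, Matrix.submatrix_mul_equiv, h2]
    · rw [IsSelfAdjoint, Matrix.star_eq_conjTranspose, Matrix.conjTranspose_submatrix, h1]

theorem equivalent_ofIndex {k l : ℕ} {ι κ : Type*} [Fintype ι] [Fintype κ] (e : ι ≃ Fin k)
    (f : κ ≃ Fin l) {p : Matrix ι ι A} {q : Matrix κ κ A} (hp : IsStarProjection p)
    (hq : IsStarProjection q) (v : Matrix ι κ A) (h1 : v * vᴴ = p) (h2 : vᴴ * v = q) :
    Equivalent (ofIndex e p hp) (ofIndex f q hq) := by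
  have h1' : v.submatrix e.symm f.symm * (v.submatrix e.symm f.symm)ᴴ =
      p.submatrix e.symm e.symm := by
    rw [Matrix.conjTranspose_submatrix, Matrix.submatrix_mul_equiv, h1]
  have h2' : (v.submatrix e.symm f.symm)ᴴ * v.submatrix e.symm f.symm =
      q.submatrix f.symm f.symm := by
    rw [Matrix.conjTranspose_submatrix, Matrix.submatrix_mul_equiv, h2]
  exact ⟨v.submatrix e.symm f.symm, h1', h2'⟩

theorem isStarProjection_fromBlocks {ι κ : Type*} [Fintype ι] [Fintype κ]
    {p : Matrix ι ι A} {q : Matrix κ κ A} (hp : IsStarProjection p) (hq : IsStarProjection q) :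
    IsStarProjection (Matrix.fromBlocks p 0 0 q) := by
  have h1 : pᴴ = p := hp.isSelfAdjoint
  have h2 : p * p = p := hp.isIdempotentElem
  have h3 : qᴴ = q := hq.isSelfAdjoint
  have h4 : q * q = q := hq.isIdempotentElem
  refine ⟨?_, ?_⟩
  · simp [IsIdempotentElem, Matrix.fromBlocks_multiply, h2, h4]
  · simp [IsSelfAdjoint, Matrix.star_eq_conjTranspose, Matrix.fromBlocks_conjTranspose, h1, h3]

/-- The block diagonal sum `p ⊕ q` of two projections. -/
def directSum (p q : MatrixProjection A) : MatrixProjection A :=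
  ofIndex finSumFinEquiv (Matrix.fromBlocks p.mat 0 0 q.mat)
    (isStarProjection_fromBlocks p.isProj q.isProj)

/-- The empty (`0 × 0`) projection. -/
def empty : MatrixProjection A := ⟨0, 0, ⟨by simp [IsIdempotentElem], by simp⟩⟩

/-- The unit of `A`, as a `1 × 1` matrix. -/
def unit : MatrixProjection A := ⟨1, 1, ⟨by simp [IsIdempotentElem], by simp⟩⟩

theorem equivalent_reindex {k l : ℕ} {ι κ : Type*} [Fintype ι] [Fintype κ] (e : ι ≃ Fin k)
    (f : κ ≃ Fin l) (g : κ ≃ ι) {p : Matrix ι ι A} {q : Matrix κ κ A} (hp : IsStarProjection p)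
    (hq : IsStarProjection q) (h : q = p.submatrix g g) :
    Equivalent (ofIndex e p hp) (ofIndex f q hq) := by
  have h1 : pᴴ = p := hp.isSelfAdjoint
  have h2 : p * p = p := hp.isIdempotentElem
  refine equivalent_ofIndex e f hp hq (p.submatrix id g) ?_ ?_
  · rw [Matrix.conjTranspose_submatrix, h1, Matrix.submatrix_mul_equiv, h2, Matrix.submatrix_id_id]
  · rw [Matrix.conjTranspose_submatrix, h1, h, ← Matrix.submatrix_mul p p g id g
      Function.bijective_id, h2]

theorem directSum_congr {p p' q q' : MatrixProjection A} (h : Equivalent p p')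
    (h' : Equivalent q q') : Equivalent (directSum p q) (directSum p' q') := by
  obtain ⟨v, h1, h2⟩ := h
  obtain ⟨w, h3, h4⟩ := h'
  refine equivalent_ofIndex _ _ _ _ (Matrix.fromBlocks v 0 0 w) ?_ ?_
  · simp [Matrix.fromBlocks_multiply, Matrix.fromBlocks_conjTranspose, h1, h3]
  · simp [Matrix.fromBlocks_multiply, Matrix.fromBlocks_conjTranspose, h2, h4]

theorem directSum_comm (p q : MatrixProjection A) :
    Equivalent (directSum p q) (directSum q p) := by
  refine equivalent_reindex _ _ (Equiv.sumComm _ _) _ _ ?_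
  ext (i | i) (j | j) <;> rfl

/-- The regrouping of `a + (b + c)` indices as `(a + b) + c` indices. -/
def regroup (a b c : ℕ) : Fin a ⊕ Fin (b + c) ≃ Fin (a + b) ⊕ Fin c :=
  ((Equiv.sumCongr (Equiv.refl _) finSumFinEquiv.symm).trans
    (Equiv.sumAssoc _ _ _).symm).trans (Equiv.sumCongr finSumFinEquiv (Equiv.refl _))

theorem fromBlocks_regroup {R : Type*} [Zero R] {a b c : ℕ} (p : Matrix (Fin a) (Fin a) R)
    (q : Matrix (Fin b) (Fin b) R) (r : Matrix (Fin c) (Fin c) R) :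
    Matrix.fromBlocks p 0 0
      ((Matrix.fromBlocks q 0 0 r).submatrix finSumFinEquiv.symm finSumFinEquiv.symm) =
    (Matrix.fromBlocks
      ((Matrix.fromBlocks p 0 0 q).submatrix finSumFinEquiv.symm finSumFinEquiv.symm)
      0 0 r).submatrix (regroup a b c) (regroup a b c) := by
  ext i j
  obtain ⟨i, rfl⟩ := (Equiv.sumCongr (Equiv.refl (Fin a))
    (finSumFinEquiv (m := b) (n := c))).surjective i
  obtain ⟨j, rfl⟩ := (Equiv.sumCongr (Equiv.refl (Fin a))
    (finSumFinEquiv (m := b) (n := c))).surjective j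
  rcases i with i | i | i <;> rcases j with j | j | j <;> simp [regroup]

theorem directSum_assoc (p q r : MatrixProjection A) :
    Equivalent (directSum (directSum p q) r) (directSum p (directSum q r)) :=
  equivalent_reindex _ _ (regroup p.size q.size r.size) _ _
    (fromBlocks_regroup p.mat q.mat r.mat)

theorem empty_directSum (p : MatrixProjection A) : Equivalent (directSum empty p) p := by
  refine equivalent_reindex (ι := Fin 0 ⊕ Fin p.size) finSumFinEquiv (Equiv.refl _)
    (Equiv.emptySum (Fin 0) (Fin p.size)).symm
    (isStarProjection_fromBlocks (empty (A := A)).isProj p.isProj) p.isProj ?_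
  rfl

end MatrixProjection

/-- The semigroup `V(A)` of equivalence classes of projections in matrix algebras over `A`. -/
def ProjectionClass (A : Type*) [Ring A] [StarRing A] : Type _ :=
  Quotient (MatrixProjection.setoid A)

namespace ProjectionClass

variable {A : Type*} [Ring A] [StarRing A]

/-- The class of a projection. -/
def mk (p : MatrixProjection A) : ProjectionClass A :=
  Quotient.mk (MatrixProjection.setoid A) p

/-- Addition of classes is induced by the block diagonal sum `p ⊕ q`, that is, by the sum of
orthogonal representatives. -/
instance instAdd : Add (ProjectionClass A) where
  add := Quotient.map₂ MatrixProjection.directSum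
    fun _ _ h _ _ h' => MatrixProjection.directSum_congr h h'

instance instZero : Zero (ProjectionClass A) where
  zero := mk MatrixProjection.empty

instance instAddCommMonoid : AddCommMonoid (ProjectionClass A) where
  add_assoc := by
    rintro ⟨p⟩ ⟨q⟩ ⟨r⟩
    exact Quotient.sound (MatrixProjection.directSum_assoc p q r)
  zero_add := by
    rintro ⟨p⟩
    exact Quotient.sound (MatrixProjection.empty_directSum p)
  add_zero := by
    rintro ⟨p⟩
    exact Quotient.sound
      ((MatrixProjection.directSum_comm p _).trans (MatrixProjection.empty_directSum p))
  add_comm := by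
    rintro ⟨p⟩ ⟨q⟩
    exact Quotient.sound (MatrixProjection.directSum_comm p q)
  nsmul := nsmulRec

end ProjectionClass

/-- The group `K₀(A)`: the Grothendieck group of the semigroup `V(A)`. -/
abbrev KZero (A : Type*) [Ring A] [StarRing A] : Type _ :=
  Algebra.GrothendieckAddGroup (ProjectionClass A)

namespace KZero

/-- The class `[p]` in `K₀(A)` of a projection `p`. -/
def ofProjection {A : Type*} [Ring A] [StarRing A] (p : MatrixProjection A) : KZero A :=
  Algebra.GrothendieckAddGroup.of (ProjectionClass.mk p)

/-- The positive cone `K₀⁺(A)`: the classes of projections. -/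
def positiveCone (A : Type*) [Ring A] [StarRing A] : Set (KZero A) :=
  Set.range ofProjection

/-- The order unit `[1]`. -/
def orderUnit (A : Type*) [Ring A] [StarRing A] : KZero A :=
  ofProjection MatrixProjection.unit

end KZero

/-! ### Bratteli diagrams -/

/-- A Bratteli diagram with `n` vertices on each level. The entry `(i, j)` of `mult k` is the
number of edges from the `i`-th vertex of level `k` to the `j`-th vertex of level `k + 1`, and
`dim i` is the size of the `i`-th matrix algebra on level `0`. -/
structure BratteliDiagram (n : ℕ) where
  mult : ℕ → Matrix (Fin n) (Fin n) ℕ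
  dim : Fin n → ℕ

namespace BratteliDiagram

/-- The product `P_k P_{k+1} ⋯ P_{l-1}` of the consecutive multiplicity matrices. -/
def block {n : ℕ} (B : BratteliDiagram n) (k l : ℕ) : Matrix (Fin n) (Fin n) ℕ :=
  ((List.Ico k l).map B.mult).prod

/-- The homomorphism `ℤⁿ → ℤⁿ` from level `k` to level `l`, given by the product of the
multiplicity matrices acting on row vectors. -/
def transition {n : ℕ} (B : BratteliDiagram n) (k l : ℕ) (_ : k ≤ l) :
    (Fin n → ℤ) →+ (Fin n → ℤ) :=
  (Matrix.vecMulLinear ((B.block k l).map (Nat.cast : ℕ → ℤ))).toAddMonoidHom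

/-- The dimension group of the diagram: the inductive limit of `ℤⁿ → ℤⁿ → ℤⁿ → ⋯`. -/
abbrev dimensionGroup {n : ℕ} (B : BratteliDiagram n) : Type :=
  AddCommGroup.DirectLimit (fun _ : ℕ => Fin n → ℤ) B.transition

/-- The image in the dimension group of a vector on level `k`. -/
noncomputable def ofLevel {n : ℕ} (B : BratteliDiagram n) (k : ℕ) : (Fin n → ℤ) →+ B.dimensionGroup :=
  AddCommGroup.DirectLimit.of (fun _ : ℕ => Fin n → ℤ) B.transition k

/-- The positive cone of the inductive limit of the simplicially ordered groups `ℤⁿ`. -/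
noncomputable def positiveCone {n : ℕ} (B : BratteliDiagram n) : Set B.dimensionGroup :=
  {g | ∃ (k : ℕ) (x : Fin n → ℤ), (∀ i, 0 ≤ x i) ∧ B.ofLevel k x = g}

/-- The order unit of the dimension group. -/
noncomputable def orderUnit {n : ℕ} (B : BratteliDiagram n) : B.dimensionGroup :=
  B.ofLevel 0 fun i => (B.dim i : ℤ)

/-- The sequence of multiplicity matrices can be divided into consecutive non-empty blocks
`{P_{s k}, …, P_{s (k+1) - 1}}` whose products are all equal to one strictly positive matrix. -/
def IsStationary {n : ℕ} (B : BratteliDiagram n) : Prop :=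
  ∃ P : Matrix (Fin n) (Fin n) ℕ, (∀ i j, 0 < P i j) ∧
    ∃ s : ℕ → ℕ, s 0 = 0 ∧ StrictMono s ∧ ∀ k, B.block (s k) (s (k + 1)) = P

end BratteliDiagram

namespace IntervalExchange

/-- `B` is a Bratteli diagram of `T`: the dimension group of `B` is isomorphic, as an ordered
group with order unit, to `(K₀, K₀⁺, [1])` of the C*-algebra of `T`. -/
def HasBratteliDiagram {n : ℕ} (T : IntervalExchange n) (B : BratteliDiagram n) : Prop :=
  ∃ e : KZero T.cstarAlgebra ≃+ B.dimensionGroup,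
    e '' KZero.positiveCone T.cstarAlgebra = B.positiveCone ∧
      e (KZero.orderUnit T.cstarAlgebra) = B.orderUnit

/-- `T` is stationary if it has a stationary Bratteli diagram. -/
def IsStationary {n : ℕ} (T : IntervalExchange n) : Prop :=
  ∃ B : BratteliDiagram n, T.HasBratteliDiagram B ∧ B.IsStationary

end IntervalExchange

/-! Lebesgue measure is invariant, so only uniqueness is at stake. It follows from two properties of
the dimension group of a stationary diagram.

First, the group has at most one state (`BratteliDiagram.IsStationary.state_unique`): along the
block ends, the values of a state on unit vectors solve a recursion given by one positive matrix,
and the non-negative solutions form a ray. Hence all normalized positive traces on the C*-algebra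
agree on projections (`IsStationary.trace_unique`). An invariant measure `μ` gives such a trace. The
algebra acts on `L²` of Lebesgue measure, to which `μ` may be singular, so the trace is built by
integrating normalized matrix coefficients at short intervals around `x` against `μ` and letting the
length tend to zero (`state`, `state_mul_comm`). On the characteristic operator of a set generated
by the intervals and their preimages, its value is the `μ`-measure of that set
(`IsClopenSet.state_indOp`). So `μ` agrees with Lebesgue measure on these sets
(`IsStationary.measure_eq`).

Second, a homomorphism with natural values on the positive cone vanishes on the order unit
(`map_orderUnit_eq_zero`); this is where `2 ≤ n` enters. So the algebra has no non-zero
finite-dimensional representation (`finrank_eq_zero`). An itinerary shared by a set of positive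
Lebesgue measure would produce one, so each itinerary has a null set of points
(`IsStationary.lebesgue_cell`).

Points sharing an itinerary up to time `N` form an interval (`SameCode.of_mem_Icc`). Thus a
half-line is, within `[0, 1)` and up to one cell of small measure, a set on which all invariant
measures agree (`IsStationary.measure_Iio_le`). -/

/-! ### Homomorphisms on `K₀` induced by traces. -/

namespace ProjectionClass

variable {A R : Type*} [Ring A] [StarRing A] [AddCommGroup R]

/-- The additive map on classes of projections induced by a trace. -/
def ofTrace (τ : A →+ R) (hτ : ∀ a b, τ (a * b) = τ (b * a)) : ProjectionClass A →+ R where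
  toFun := Quotient.lift (fun p : MatrixProjection A => ∑ i, τ (p.mat i i)) (by
    rintro p q ⟨v, h1, h2⟩
    simp only [← h1, ← h2, Matrix.mul_apply, map_sum]
    rw [Finset.sum_comm]
    exact Finset.sum_congr rfl fun i _ => Finset.sum_congr rfl fun j _ => hτ _ _)
  map_zero' := by
    change ∑ i : Fin 0, _ = (0 : R)
    simp
  map_add' := by
    rintro ⟨p⟩ ⟨q⟩
    change ∑ i, τ ((MatrixProjection.directSum p q).mat i i) =
      ∑ i, τ (p.mat i i) + ∑ i, τ (q.mat i i)
    change ∑ i : Fin (p.size + q.size), τ ((Matrix.fromBlocks p.mat 0 0 q.mat).submatrix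
      finSumFinEquiv.symm finSumFinEquiv.symm i i) = _
    rw [← finSumFinEquiv.sum_comp, Fintype.sum_sum_type]
    simp

end ProjectionClass

namespace KZero

variable {A R : Type*} [Ring A] [StarRing A] [AddCommGroup R]

/-- The homomorphism on `K₀` induced by a trace. -/
noncomputable def ofTrace (τ : A →+ R) (hτ : ∀ a b, τ (a * b) = τ (b * a)) : KZero A →+ R :=
  Algebra.GrothendieckAddGroup.lift (ProjectionClass.ofTrace τ hτ)

theorem ofTrace_ofProjection (τ : A →+ R) (hτ : ∀ a b, τ (a * b) = τ (b * a))
    (p : MatrixProjection A) : ofTrace τ hτ (ofProjection p) = ∑ i, τ (p.mat i i) := by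
  have h := DFunLike.congr_fun (Algebra.GrothendieckAddGroup.lift.symm_apply_apply
    (ProjectionClass.ofTrace τ hτ)) (ProjectionClass.mk p)
  exact h

theorem ofTrace_orderUnit (τ : A →+ R) (hτ : ∀ a b, τ (a * b) = τ (b * a)) :
    ofTrace τ hτ (orderUnit A) = τ 1 := by
  rw [orderUnit, ofTrace_ofProjection]
  change ∑ i : Fin 1, τ ((1 : Matrix (Fin 1) (Fin 1) A) i i) = _
  simp

/-- A projection of `A`, as a `1 × 1` matrix. -/
def _root_.MatrixProjection.single (p : A) (hp : IsStarProjection p) : MatrixProjection A where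
  size := 1
  mat := Matrix.of fun _ _ => p
  isProj := by
    refine ⟨?_, ?_⟩
    · ext i j
      simpa [Matrix.mul_apply] using hp.isIdempotentElem.eq
    · ext i j
      simpa [Matrix.star_apply] using hp.isSelfAdjoint.star_eq

theorem ofTrace_single (τ : A →+ R) (hτ : ∀ a b, τ (a * b) = τ (b * a)) (p : A)
    (hp : IsStarProjection p) :
    ofTrace τ hτ (ofProjection (MatrixProjection.single p hp)) = τ p := by
  rw [ofTrace_ofProjection]
  change ∑ i : Fin 1, τ p = _
  simp

/-- A trace which is non-negative on the elements `a⋆ a` is non-negative on projections. -/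
theorem ofTrace_nonneg (τ : A →+ ℝ) (hτ : ∀ a b, τ (a * b) = τ (b * a))
    (hpos : ∀ a, 0 ≤ τ (star a * a)) {g : KZero A} (hg : g ∈ positiveCone A) :
    0 ≤ ofTrace τ hτ g := by
  obtain ⟨p, rfl⟩ := hg
  rw [ofTrace_ofProjection]
  refine Finset.sum_nonneg fun i _ => ?_
  have h1 : star p.mat = p.mat := p.isProj.isSelfAdjoint
  have h2 : p.mat * p.mat = p.mat := p.isProj.isIdempotentElem
  -- Writing `p = p⋆ p` turns each diagonal entry into a sum of elements `a⋆ a`.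
  rw [← h2]
  conv in p.mat * p.mat => lhs; rw [← h1]
  rw [Matrix.mul_apply, map_sum]
  exact Finset.sum_nonneg fun j _ => hpos _

/-- The trace in a finite-dimensional representation maps projections to natural numbers. -/
theorem exists_nat_ofTrace {W : Type*} [AddCommGroup W] [Module ℂ W] [FiniteDimensional ℂ W]
    (ρ : A →+* Module.End ℂ W) (τ : A →+ ℂ) (h : ∀ a, τ a = LinearMap.trace ℂ W (ρ a))
    (hτ : ∀ a b, τ (a * b) = τ (b * a))
    {g : KZero A} (hg : g ∈ positiveCone A) : ∃ m : ℕ, ofTrace τ hτ g = m := by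
  obtain ⟨p, rfl⟩ := hg
  rw [ofTrace_ofProjection]
  let b := Module.finBasis ℂ W
  let ρ' : A →+* Matrix (Fin (Module.finrank ℂ W)) (Fin (Module.finrank ℂ W)) ℂ :=
    (LinearMap.toMatrixAlgEquiv b : _ →ₐ[ℂ] _).toRingHom.comp ρ
  have htr : ∀ a, τ a = (ρ' a).trace := fun a => by
    rw [h, LinearMap.trace_eq_matrix_trace ℂ b]
    rfl
  -- Flattening the matrix of matrices gives one idempotent complex matrix, whose trace is its rank.
  let M := Matrix.compRingEquiv (Fin p.size) (Fin (Module.finrank ℂ W)) ℂ (p.mat.map ρ')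
  have hM : M * M = M := by
    have h2 : p.mat * p.mat = p.mat := p.isProj.isIdempotentElem
    rw [← map_mul, ← Matrix.map_mul, h2]
  have hs : ∑ i, τ (p.mat i i) = M.trace := by
    simp only [htr, Matrix.trace, Fintype.sum_prod_type]
    rfl
  rw [hs, ← Matrix.trace_toLin'_eq]
  have hI : IsIdempotentElem (Matrix.toLin' M) := by
    rw [IsIdempotentElem, Module.End.mul_eq_comp, ← Matrix.toLin'_mul, hM]
  exact ⟨_, (LinearMap.IsIdempotentElem.isProj_range _ hI).trace⟩

end KZero

/-! ### States and integer-valued homomorphisms of stationary dimension groups. -/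

namespace BratteliDiagram

variable {n : ℕ} {P : Matrix (Fin n) (Fin n) ℕ}

theorem ofLevel_transition (B : BratteliDiagram n) {k l : ℕ} (h : k ≤ l) (x : Fin n → ℤ) :
    B.ofLevel l (B.transition k l h x) = B.ofLevel k x :=
  AddCommGroup.DirectLimit.of_f (G := fun _ : ℕ => Fin n → ℤ) (f := B.transition) h x

theorem map_ofLevel {R : Type*} [AddCommGroup R] (B : BratteliDiagram n)
    (s : B.dimensionGroup →+ R) (k : ℕ) (x : Fin n → ℤ) :
    s (B.ofLevel k x) = ∑ i, x i • s (B.ofLevel k (Pi.single i 1)) := by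
  have hx : x = ∑ i, x i • Pi.single i (1 : ℤ) := by
    ext j
    simp [Finset.sum_apply, Pi.single_apply]
  conv_lhs => rw [hx]
  simp only [map_sum, map_zsmul]

theorem map_single_eq {R : Type*} [AddCommGroup R] (B : BratteliDiagram n)
    (s : B.dimensionGroup →+ R) {k l : ℕ} (h : k ≤ l) (i : Fin n) :
    s (B.ofLevel k (Pi.single i 1)) =
      ∑ j, B.block k l i j • s (B.ofLevel l (Pi.single j 1)) := by
  rw [← B.ofLevel_transition h, map_ofLevel]
  refine Finset.sum_congr rfl fun j _ => ?_
  have : B.transition k l h (Pi.single i 1) j = (B.block k l i j : ℤ) := by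
    simp [transition]
  rw [this, natCast_zsmul]

theorem ofLevel_mem_positiveCone (B : BratteliDiagram n) (k : ℕ) (i : Fin n) :
    B.ofLevel k (Pi.single i 1) ∈ B.positiveCone :=
  ⟨k, _, fun j => by by_cases h : j = i <;> simp [h], rfl⟩

/-- A non-negative solution of the recursion that is non-zero at the start dominates a multiple
of every other non-negative solution. -/
theorem exists_mul_le (hP : ∀ i j, 0 < P i j) {y z : ℕ → Fin n → ℝ} (hy : ∀ k i, 0 ≤ y k i)
    (hz : ∀ k i, 0 ≤ z k i) (hyP : ∀ k i, y k i = ∑ j, P i j * y (k + 1) j)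
    (hzP : ∀ k i, z k i = ∑ j, P i j * z (k + 1) j) {i₀ : Fin n} (h0 : 0 < z 0 i₀) :
    ∃ δ > 0, ∀ k i, δ * y k i ≤ z k i := by
  -- The summand `1` in the denominator covers the case `y 0 i₀ = 0`.
  obtain ⟨ε, hε, hε0⟩ : ∃ ε > 0, ε * y 0 i₀ < z 0 i₀ := by
    refine ⟨z 0 i₀ / (y 0 i₀ + 1), div_pos h0 (by linarith [hy 0 i₀]), ?_⟩
    rw [div_mul_eq_mul_div, div_lt_iff₀ (by linarith [hy 0 i₀])]
    nlinarith
  -- If `z ≤ ε y` held in all coordinates of level `k`, the recursion would carry it down to level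
  -- `0`, against the choice of `ε`.
  have hex : ∀ k, ∃ i, ε * y k i < z k i := by
    intro k
    by_contra! h
    have : ∀ m ≤ k, ∀ i, z m i ≤ ε * y m i := by
      intro m hm
      induction hm using Nat.decreasingInduction with
      | self => exact h
      | of_succ m _ ih =>
        intro i
        rw [hzP, hyP, Finset.mul_sum]
        refine Finset.sum_le_sum fun j _ => ?_
        nlinarith [ih j, (Nat.cast_nonneg (P i j) : (0 : ℝ) ≤ P i j)]
    exact absurd (this 0 k.zero_le i₀) (not_le.2 hε0)
  obtain ⟨C, hC⟩ : ∃ C : ℕ, ∀ i j, P i j ≤ C :=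
    ⟨∑ i, ∑ j, P i j, fun i j => (Finset.single_le_sum (f := fun j => P i j)
      (fun _ _ => Nat.zero_le _) (Finset.mem_univ j)).trans
      (Finset.single_le_sum (f := fun i => ∑ j, P i j)
        (fun _ _ => Nat.zero_le _) (Finset.mem_univ i))⟩
  have hC0 : (0 : ℝ) < C := by exact_mod_cast (hP i₀ i₀).trans_le (hC i₀ i₀)
  -- Entries of `P` lie between `1` and `C`, so every coordinate of a solution at level `k` lies
  -- between the coordinate sum at level `k + 1` and `C` times it. One good coordinate therefore
  -- controls all of them, at the cost of a factor `C` for `y` and another for `z`.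
  have hlow : ∀ w : ℕ → Fin n → ℝ, (∀ k i, 0 ≤ w k i) →
      (∀ k i, w k i = ∑ j, P i j * w (k + 1) j) → ∀ k i, ∑ j, w (k + 1) j ≤ w k i := by
    intro w hw hwP k i
    rw [hwP]
    refine Finset.sum_le_sum fun j _ => le_mul_of_one_le_left (hw _ _) ?_
    exact_mod_cast hP i j
  have hupp : ∀ w : ℕ → Fin n → ℝ, (∀ k i, 0 ≤ w k i) →
      (∀ k i, w k i = ∑ j, P i j * w (k + 1) j) → ∀ k i, w k i ≤ C * ∑ j, w (k + 1) j := by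
    intro w hw hwP k i
    rw [hwP, Finset.mul_sum]
    refine Finset.sum_le_sum fun j _ => mul_le_mul_of_nonneg_right ?_ (hw _ _)
    exact_mod_cast hC i j
  refine ⟨ε / (C * C), by positivity, fun k i => ?_⟩
  obtain ⟨l, hl⟩ := hex k
  have e1 := hlow z hz hzP k i
  have e2 := hupp z hz hzP k l
  have e3 := hlow y hy hyP k l
  have e4 := hupp y hy hyP k i
  rw [div_mul_eq_mul_div, div_le_iff₀ (by positivity)]
  have e5 : ε * ∑ j, y (k + 1) j ≤ C * ∑ j, z (k + 1) j := by nlinarith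
  calc ε * y k i ≤ ε * (C * ∑ j, y (k + 1) j) := by gcongr
    _ = C * (ε * ∑ j, y (k + 1) j) := by ring
    _ ≤ C * (C * ∑ j, z (k + 1) j) := by gcongr
    _ ≤ C * (C * z k i) := by gcongr
    _ = z k i * (C * C) := by ring

/-- The non-negative solutions of the recursion given by a positive matrix form a ray. -/
theorem exists_eq_mul (hP : ∀ i j, 0 < P i j) {x y : ℕ → Fin n → ℝ} (hx : ∀ k i, 0 ≤ x k i)
    (hy : ∀ k i, 0 ≤ y k i) (hxP : ∀ k i, x k i = ∑ j, P i j * x (k + 1) j)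
    (hyP : ∀ k i, y k i = ∑ j, P i j * y (k + 1) j) {i₀ : Fin n} (h0 : 0 < y 0 i₀) :
    ∃ t : ℝ, ∀ i, x 0 i = t * y 0 i := by
  -- The largest multiple of `y` below `x` exists since `S` is closed and bounded above. If the
  -- difference is non-zero at the start, it dominates a further `δ y`, contradicting maximality.
  let S : Set ℝ := {t | ∀ k i, t * y k i ≤ x k i}
  have hne : S.Nonempty := ⟨0, fun k i => by simpa using hx k i⟩
  have hbd : BddAbove S := ⟨x 0 i₀ / y 0 i₀, fun t ht => (le_div_iff₀ h0).2 (ht 0 i₀)⟩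
  have hcl : IsClosed S := by
    simp only [S, Set.ofPred_forall]
    exact isClosed_iInter fun k => isClosed_iInter fun i =>
      isClosed_le (by fun_prop) continuous_const
  have ht : sSup S ∈ S := hcl.csSup_mem hne hbd
  refine ⟨sSup S, fun i => ?_⟩
  by_contra hi
  have hpos : 0 < x 0 i - sSup S * y 0 i := sub_pos.2 (lt_of_le_of_ne (ht 0 i) (Ne.symm hi))
  obtain ⟨δ, hδ, h⟩ := exists_mul_le hP (z := fun k i => x k i - sSup S * y k i) hy
    (fun k i => sub_nonneg.2 (ht k i)) hyP (fun k i => by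
      rw [hxP, hyP, Finset.mul_sum, ← Finset.sum_sub_distrib]
      exact Finset.sum_congr rfl fun j _ => by ring) hpos
  have : sSup S + δ ∈ S := fun k i => by linarith [h k i]
  linarith [le_csSup hbd this]

/-- Compatibility with the transition maps, read only at block ends, turns any real homomorphism
into a solution of a recursion with a constant positive matrix. -/
theorem IsStationary.exists_recursion {B : BratteliDiagram n} (hB : B.IsStationary) :
    ∃ P : Matrix (Fin n) (Fin n) ℕ, (∀ i j, 0 < P i j) ∧ ∃ σ : ℕ → ℕ, σ 0 = 0 ∧ StrictMono σ ∧
      ∀ (s : B.dimensionGroup →+ ℝ) (k : ℕ) (i : Fin n),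
        s (B.ofLevel (σ k) (Pi.single i 1)) =
          ∑ j, P i j * s (B.ofLevel (σ (k + 1)) (Pi.single j 1)) := by
  obtain ⟨P, hP, σ, h0, hσ, h⟩ := hB
  refine ⟨P, hP, σ, h0, hσ, fun s k i => ?_⟩
  rw [map_single_eq B s (hσ k.lt_succ_self).le, h]
  simp

/-- The dimension group of a stationary diagram has at most one state. -/
theorem IsStationary.state_unique {B : BratteliDiagram n} (hB : B.IsStationary)
    {s t : B.dimensionGroup →+ ℝ} (hs : ∀ g ∈ B.positiveCone, 0 ≤ s g)
    (ht : ∀ g ∈ B.positiveCone, 0 ≤ t g) (hs1 : s B.orderUnit = 1) (ht1 : t B.orderUnit = 1) :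
    s = t := by
  obtain ⟨P, hP, σ, h0, hσ, h⟩ := hB.exists_recursion
  -- Dropping the first `m` blocks leaves the same recursion, so the comparison at the start in
  -- `exists_eq_mul` becomes a comparison at level `σ m`.
  have shift : ∀ m, ∀ s : B.dimensionGroup →+ ℝ, ∀ k i,
      s (B.ofLevel (σ (k + m)) (Pi.single i 1)) =
        ∑ j, P i j * s (B.ofLevel (σ (k + 1 + m)) (Pi.single j 1)) := fun m s k i => by
    rw [h s (k + m) i, add_right_comm]
  have key : ∀ m, ∃ c : ℝ, ∀ i, s (B.ofLevel (σ m) (Pi.single i 1)) =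
      c * t (B.ofLevel (σ m) (Pi.single i 1)) := by
    intro m
    -- If `t` vanished on one whole level, it would vanish on the order unit, which maps into that
    -- level.
    have hne : ∃ i, 0 < t (B.ofLevel (σ m) (Pi.single i 1)) := by
      by_contra! hle
      have hz : ∀ x, t (B.ofLevel (σ m) x) = 0 := fun x => by
        rw [map_ofLevel]
        refine Finset.sum_eq_zero fun i _ => ?_
        rw [le_antisymm (hle i) (ht _ (B.ofLevel_mem_positiveCone _ i)), smul_zero]
      rw [orderUnit, ← B.ofLevel_transition (Nat.zero_le (σ m)), hz] at ht1
      exact zero_ne_one ht1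
    obtain ⟨i₀, hi₀⟩ := hne
    have := exists_eq_mul hP (x := fun k i => s (B.ofLevel (σ (k + m)) (Pi.single i 1)))
      (y := fun k i => t (B.ofLevel (σ (k + m)) (Pi.single i 1)))
      (fun k i => hs _ (B.ofLevel_mem_positiveCone _ i))
      (fun k i => ht _ (B.ofLevel_mem_positiveCone _ i)) (shift m s) (shift m t)
      (i₀ := i₀) (by simpa using hi₀)
    simpa using this
  refine AddMonoidHom.ext fun g => ?_
  induction g using AddCommGroup.DirectLimit.induction_on with
  | ih k x =>
    have hk : k ≤ σ k := hσ.le_apply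
    obtain ⟨c, hc⟩ := key (k)
    have hall : ∀ x, s (B.ofLevel (σ k) x) = c * t (B.ofLevel (σ k) x) := fun x => by
      rw [map_ofLevel, map_ofLevel, Finset.mul_sum]
      refine Finset.sum_congr rfl fun i _ => ?_
      rw [hc, zsmul_eq_mul, zsmul_eq_mul]
      ring
    -- The order unit, pushed to level `σ k`, fixes the factor.
    have hc1 : c = 1 := by
      have := hall (B.transition 0 (σ k) (Nat.zero_le _) fun i => (B.dim i : ℤ))
      rw [B.ofLevel_transition] at this
      change s B.orderUnit = c * t B.orderUnit at this
      rw [hs1, ht1] at this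
      linarith
    have := hall (B.transition k (σ k) hk x)
    rw [B.ofLevel_transition, hc1, one_mul] at this
    exact this

/-- The dimension group of a stationary diagram with at least two vertices on each level has no
non-trivial homomorphism which maps the positive cone to natural numbers. -/
theorem IsStationary.map_orderUnit_eq_zero {B : BratteliDiagram n} (hn : 2 ≤ n)
    (hB : B.IsStationary) {s : B.dimensionGroup →+ ℝ}
    (hs : ∀ g ∈ B.positiveCone, ∃ m : ℕ, s g = m) : s B.orderUnit = 0 := by
  obtain ⟨P, hP, σ, h0, hσ, h⟩ := hB.exists_recursion
  choose! x hx using fun k i => hs _ (B.ofLevel_mem_positiveCone (σ k) i)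
  have hrec : ∀ k i, ∑ j, x (k + 1) j ≤ x k i := fun k i => by
    have h1 := h s k i
    simp only [hx] at h1
    have h2 : x k i = ∑ j, P i j * x (k + 1) j := by exact_mod_cast h1
    rw [h2]
    exact Finset.sum_le_sum fun j _ => Nat.le_mul_of_pos_left _ (hP i j)
  -- Each of the `n ≥ 2` coordinates at level `k` is at least the whole sum at level `k + 1`, so the
  -- sums at least halve.
  have hdecay : ∀ k, 2 * ∑ j, x (k + 1) j ≤ ∑ i, x k i := fun k =>
    calc 2 * ∑ j, x (k + 1) j ≤ n * ∑ j, x (k + 1) j := Nat.mul_le_mul_right _ hn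
      _ = ∑ _i : Fin n, ∑ j, x (k + 1) j := by simp
      _ ≤ ∑ i, x k i := Finset.sum_le_sum fun i _ => hrec k i
  have hpow : ∀ k, 2 ^ k * ∑ j, x k j ≤ ∑ i, x 0 i := by
    intro k
    induction k with
    | zero => simp
    | succ k ih =>
      calc 2 ^ (k + 1) * ∑ j, x (k + 1) j = 2 ^ k * (2 * ∑ j, x (k + 1) j) := by ring
        _ ≤ 2 ^ k * ∑ j, x k j := Nat.mul_le_mul_left _ (hdecay k)
        _ ≤ _ := ih
  -- Starting from `N`, a natural number halved `N` times must be zero because `N < 2 ^ N`.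
  set N := ∑ i, x 0 i with hN
  have hzero : ∑ j, x N j = 0 := by
    by_contra hne
    have h1 : 2 ^ N ≤ N := (Nat.le_mul_of_pos_right _ (Nat.pos_of_ne_zero hne)).trans (hpow N)
    exact absurd h1 (not_le.2 Nat.lt_two_pow_self)
  rw [orderUnit, ← B.ofLevel_transition (Nat.zero_le (σ N)), map_ofLevel]
  refine Finset.sum_eq_zero fun i _ => ?_
  rw [hx, (Finset.sum_eq_zero_iff.1 hzero) i (Finset.mem_univ i)]
  simp

end BratteliDiagram

/-! ### Consequences for traces and representations of the C*-algebra. -/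

namespace IntervalExchange

variable {n : ℕ}

/-- Two traces on the C*-algebra of a stationary interval exchange transformation agree on
projections. -/
theorem IsStationary.trace_unique {T : IntervalExchange n} (hT : T.IsStationary)
    {τ υ : T.cstarAlgebra →+ ℝ} (hτ : ∀ a b, τ (a * b) = τ (b * a))
    (hυ : ∀ a b, υ (a * b) = υ (b * a)) (hτ0 : ∀ a, 0 ≤ τ (star a * a))
    (hυ0 : ∀ a, 0 ≤ υ (star a * a)) (hτ1 : τ 1 = 1) (hυ1 : υ 1 = 1) {p : T.cstarAlgebra}
    (hp : IsStarProjection p) : τ p = υ p := by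
  obtain ⟨B, ⟨e, he, he1⟩, hB⟩ := hT
  have hpos : ∀ g ∈ B.positiveCone, e.symm g ∈ KZero.positiveCone T.cstarAlgebra := by
    intro g hg
    rw [← he] at hg
    obtain ⟨x, hx, rfl⟩ := hg
    simpa using hx
  have hunit : e.symm B.orderUnit = KZero.orderUnit T.cstarAlgebra := by
    rw [← he1, e.symm_apply_apply]
  have key := hB.state_unique (s := (KZero.ofTrace τ hτ).comp e.symm.toAddMonoidHom)
    (t := (KZero.ofTrace υ hυ).comp e.symm.toAddMonoidHom)
    (fun g hg => KZero.ofTrace_nonneg τ hτ hτ0 (hpos g hg))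
    (fun g hg => KZero.ofTrace_nonneg υ hυ hυ0 (hpos g hg))
    ((congrArg _ hunit).trans ((KZero.ofTrace_orderUnit τ hτ).trans hτ1))
    ((congrArg _ hunit).trans ((KZero.ofTrace_orderUnit υ hυ).trans hυ1))
  have h := DFunLike.congr_fun key (e (KZero.ofProjection (MatrixProjection.single p hp)))
  simpa [KZero.ofTrace_single] using h

/-- The C*-algebra of a stationary interval exchange transformation has no non-trivial
finite-dimensional representation. -/
theorem IsStationary.finrank_eq_zero (hn : 2 ≤ n) {T : IntervalExchange n} (hT : T.IsStationary)
    {W : Type*} [AddCommGroup W] [Module ℂ W] [FiniteDimensional ℂ W]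
    (ρ : T.cstarAlgebra →+* Module.End ℂ W) : Module.finrank ℂ W = 0 := by
  obtain ⟨B, ⟨e, he, he1⟩, hB⟩ := hT
  let τ : T.cstarAlgebra →+ ℂ := (LinearMap.trace ℂ W).toAddMonoidHom.comp ρ.toAddMonoidHom
  have hτ : ∀ a b, τ (a * b) = τ (b * a) := fun a b => by
    change LinearMap.trace ℂ W (ρ (a * b)) = LinearMap.trace ℂ W (ρ (b * a))
    rw [map_mul ρ, map_mul ρ, LinearMap.trace_mul_comm]
  -- The trace of the representation has natural values on projections, and its value at `[1]` is
  -- the dimension of `W`.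
  have key := hB.map_orderUnit_eq_zero hn
    (s := Complex.reLm.toAddMonoidHom.comp
      ((KZero.ofTrace τ hτ).comp e.symm.toAddMonoidHom)) (by
      intro g hg
      rw [← he] at hg
      obtain ⟨x, hx, rfl⟩ := hg
      obtain ⟨m, hm⟩ := KZero.exists_nat_ofTrace ρ τ (fun _ => rfl) hτ hx
      refine ⟨m, ?_⟩
      change (KZero.ofTrace τ hτ (e.symm (e x))).re = m
      rw [e.symm_apply_apply, hm, Complex.natCast_re])
  change (KZero.ofTrace τ hτ (e.symm B.orderUnit)).re = 0 at key
  rw [← he1, e.symm_apply_apply, KZero.ofTrace_orderUnit] at key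
  change (LinearMap.trace ℂ W (ρ 1)).re = 0 at key
  rw [map_one, LinearMap.trace_one, Complex.natCast_re] at key
  exact_mod_cast key

end IntervalExchange

/-! ### Multiplication operators, the Koopman unitary and reducing subspaces. -/

namespace IntervalExchange

instance : IsProbabilityMeasure lebesgue := ⟨by simp [lebesgue]⟩

/-- The operator of multiplication by the characteristic function of a measurable set. -/
noncomputable def indOp (s : Set ℝ) (hs : MeasurableSet s) : Hilbert →L[ℂ] Hilbert :=
  (ContinuousLinearMap.mul ℂ ℂ).holderL lebesgue ⊤ 2 2
    (indicatorConstLp ⊤ hs (measure_ne_top _ _) 1)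

theorem indOp_apply (s : Set ℝ) (hs : MeasurableSet s) (ζ : Hilbert) :
    indOp s hs ζ =ᵐ[lebesgue] s.indicator ζ := by
  refine (ContinuousLinearMap.coeFn_holder (r := 2) (ContinuousLinearMap.mul ℂ ℂ) _ ζ).trans ?_
  filter_upwards [indicatorConstLp_coeFn (p := ⊤) (μ := lebesgue) (c := (1 : ℂ))
    (hs := hs) (hμs := measure_ne_top _ _)] with x hx
  rw [hx]
  change s.indicator (fun _ => (1 : ℂ)) x * ζ x = _
  by_cases h : x ∈ s <;> simp [h]

/-- The characteristic function of a measurable set, as a vector. -/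
noncomputable def indVec (s : Set ℝ) (hs : MeasurableSet s) : Hilbert :=
  indicatorConstLp 2 hs (measure_ne_top _ _) 1

theorem indVec_congr {s t : Set ℝ} {hs : MeasurableSet s} {ht : MeasurableSet t}
    (h : s =ᵐ[lebesgue] t) : indVec s hs = indVec t ht :=
  (indicatorConstLp_inj hs _ ht _ one_ne_zero).2 h

theorem indVec_ne_zero {s : Set ℝ} {hs : MeasurableSet s} (h : lebesgue s ≠ 0) :
    indVec s hs ≠ 0 := by
  intro h0
  have : indVec s hs = indVec ∅ MeasurableSet.empty := h0.trans indicatorConstLp_empty.symm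
  exact h (ae_eq_empty.1 ((indicatorConstLp_inj hs _ MeasurableSet.empty _ one_ne_zero).1 this))

theorem indOp_indVec (s t : Set ℝ) (hs : MeasurableSet s) (ht : MeasurableSet t) :
    indOp s hs (indVec t ht) = indVec (s ∩ t) (hs.inter ht) := by
  refine Lp.ext ((indOp_apply s hs _).trans ?_)
  filter_upwards [indicatorConstLp_coeFn (p := 2) (μ := lebesgue) (c := (1 : ℂ))
    (hs := ht) (hμs := measure_ne_top _ _), indicatorConstLp_coeFn (p := 2) (μ := lebesgue)
    (c := (1 : ℂ)) (hs := hs.inter ht) (hμs := measure_ne_top _ _)] with x h1 h2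
  change s.indicator (⇑(indicatorConstLp 2 ht _ 1)) x = (indicatorConstLp 2 (hs.inter ht) _ 1) x
  rw [h2]
  by_cases h : x ∈ s <;> by_cases h' : x ∈ t <;> simp [h, h', h1]

theorem norm_indVec_sq (s : Set ℝ) (hs : MeasurableSet s) :
    ‖indVec s hs‖ ^ 2 = lebesgue.real s := by
  have h := L2.inner_indicatorConstLp_one_indicatorConstLp_one (𝕜 := ℂ) (μ := lebesgue) hs hs
  rw [Set.inter_self] at h
  have h2 := inner_self_eq_norm_sq_to_K (𝕜 := ℂ) (indVec s hs)
  rw [show inner ℂ (indVec s hs) (indVec s hs) = _ from h] at h2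
  exact_mod_cast h2.symm

theorem indOp_mul (s t : Set ℝ) (hs : MeasurableSet s) (ht : MeasurableSet t) :
    indOp s hs * indOp t ht = indOp (s ∩ t) (hs.inter ht) := by
  refine ContinuousLinearMap.ext fun ζ => Lp.ext ?_
  filter_upwards [indOp_apply s hs (indOp t ht ζ), indOp_apply t ht ζ,
    indOp_apply (s ∩ t) (hs.inter ht) ζ] with x h1 h2 h3
  rw [mul_apply_eq_comp, h1, h3]
  by_cases h : x ∈ s <;> by_cases h' : x ∈ t <;> simp [h, h', h2]

theorem indOp_compl (s : Set ℝ) (hs : MeasurableSet s) : indOp sᶜ hs.compl = 1 - indOp s hs := by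
  refine ContinuousLinearMap.ext fun ζ => Lp.ext ?_
  filter_upwards [indOp_apply s hs ζ, indOp_apply sᶜ hs.compl ζ,
    Lp.coeFn_sub ζ (indOp s hs ζ)] with x h1 h2 h3
  rw [sub_apply, one_apply_eq_self, h3, Pi.sub_apply, h1, h2]
  by_cases h : x ∈ s <;> simp [h]

theorem isSelfAdjoint_indOp (s : Set ℝ) (hs : MeasurableSet s) : IsSelfAdjoint (indOp s hs) := by
  rw [ContinuousLinearMap.isSelfAdjoint_iff_isSymmetric]
  intro ζ ξ
  simp only [ContinuousLinearMap.coe_coe, L2.inner_def]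
  refine integral_congr_ae ?_
  filter_upwards [indOp_apply s hs ζ, indOp_apply s hs ξ] with x h1 h2
  rw [h1, h2]
  by_cases h : x ∈ s <;> simp [h]

theorem isStarProjection_indOp (s : Set ℝ) (hs : MeasurableSet s) :
    IsStarProjection (indOp s hs) := by
  refine ⟨?_, isSelfAdjoint_indOp s hs⟩
  rw [IsIdempotentElem, indOp_mul]
  simp only [Set.inter_self]

variable {n : ℕ} (T : IntervalExchange n)

theorem measurableSet_interval (i : Fin n) : MeasurableSet (T.interval i) := measurableSet_Ico

theorem charOp_eq (i : Fin n) : T.charOp i = indOp (T.interval i) (T.measurableSet_interval i) :=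
  rfl

theorem koopman_apply (ζ : Hilbert) : T.koopman ζ =ᵐ[lebesgue] ζ ∘ T.toFun :=
  Lp.coeFn_compMeasurePreserving ζ T.measurePreserving

theorem koopman_indVec (s : Set ℝ) (hs : MeasurableSet s) :
    T.koopman (indVec s hs) = indVec (T.toFun ⁻¹' s) (T.measurable_toFun hs) :=
  Lp.indicatorConstLp_compMeasurePreserving hs _ 1 T.measurePreserving

theorem koopman_indOp (s : Set ℝ) (hs : MeasurableSet s) :
    T.koopman * indOp s hs = indOp (T.toFun ⁻¹' s) (T.measurable_toFun hs) * T.koopman := by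
  refine ContinuousLinearMap.ext fun ζ => Lp.ext ?_
  filter_upwards [T.koopman_apply (indOp s hs ζ), T.koopman_apply ζ,
    T.measurePreserving.quasiMeasurePreserving.ae (indOp_apply s hs ζ),
    indOp_apply _ (T.measurable_toFun hs) (T.koopman ζ)] with x h1 h2 h3 h4
  rw [mul_apply_eq_comp, mul_apply_eq_comp, h1, h4, Function.comp_apply,
    h3]
  by_cases h : T.toFun x ∈ s
  · rw [Set.indicator_of_mem h, Set.indicator_of_mem (Set.mem_preimage.2 h), h2]; rfl
  · rw [Set.indicator_of_notMem h, Set.indicator_of_notMem (Set.mem_preimage.not.2 h)]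

/-- The interval exchange transformation which is inverse to `T` off the endpoints. -/
def inverse : IntervalExchange n where
  len k := T.len (T.perm.symm k)
  len_pos k := T.len_pos _
  sum_len := by rw [← T.sum_len]; exact Equiv.sum_comp T.perm.symm T.len
  perm := T.perm.symm
  sign k := T.sign (T.perm.symm k)

theorem iUnion_interval : (⋃ i, T.interval i) = Set.Ico 0 1 := by
  rw [← T.sum_len]
  exact (start_tiling T.len T.len_pos).1

theorem inverse_left (i : Fin n) : T.inverse.left (T.perm i) = T.imageLeft i := rfl

theorem inverse_imageLeft (i : Fin n) : T.inverse.imageLeft (T.perm i) = T.left i := by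
  simp [inverse, imageLeft, left]

theorem inverse_toFun {i : Fin n} {x : ℝ}
    (hx : x ∈ Set.Ioo (T.left i) (T.left i + T.len i)) : T.inverse.toFun (T.toFun x) = x := by
  have hlen : T.inverse.len (T.perm i) = T.len i := by simp [inverse]
  have hsign : T.inverse.sign (T.perm i) = T.sign i := by simp [inverse]
  rw [T.toFun_eq i ⟨hx.1.le, hx.2⟩, T.inverse.toFun_eq (T.perm i)]
  · simp only [piece, hsign, inverse_left, inverse_imageLeft, hlen]
    split_ifs <;> ring
  · rw [interval, inverse_left, hlen, piece]
    split_ifs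
    · constructor <;> linarith [hx.1, hx.2]
    · constructor <;> linarith [hx.1, hx.2]

theorem ae_mem_interior : ∀ᵐ x ∂lebesgue, ∃ i, x ∈ Set.Ioo (T.left i) (T.left i + T.len i) := by
  have h1 : ∀ᵐ x ∂lebesgue, x ∈ Set.Ico (0 : ℝ) 1 := ae_restrict_mem measurableSet_Ico
  have h2 : ∀ᵐ x ∂lebesgue, ∀ i, x ≠ T.left i := by
    refine ae_all_iff.2 fun i => ?_
    refine ae_restrict_of_ae ?_
    simp [ae_iff]
  filter_upwards [h1, h2] with x hx hx'
  rw [← T.iUnion_interval] at hx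
  obtain ⟨i, hi⟩ := Set.mem_iUnion.1 hx
  exact ⟨i, lt_of_le_of_ne hi.1 (hx' i).symm, hi.2⟩

theorem star_koopman_mul : star T.koopman * T.koopman = 1 := by
  refine ContinuousLinearMap.ext fun ζ => ?_
  exact T.unitaryOp_comp ζ

/-- The inverse exchange undoes `T` in the interiors of the intervals; the endpoints, where flips
may spoil this, are Lebesgue-null. Hence the Koopman isometry is onto, and its adjoint is a
two-sided inverse. -/
theorem koopman_mul_inverse : T.koopman * T.inverse.koopman = 1 := by
  refine ContinuousLinearMap.ext fun ζ => Lp.ext ?_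
  filter_upwards [T.koopman_apply (T.inverse.koopman ζ),
    T.measurePreserving.quasiMeasurePreserving.ae (T.inverse.koopman_apply ζ),
    T.ae_mem_interior] with x h1 h2 ⟨i, hi⟩
  rw [mul_apply_eq_comp, h1, Function.comp_apply, h2, Function.comp_apply,
    T.inverse_toFun hi]
  rfl

theorem koopman_mul_star : T.koopman * star T.koopman = 1 := by
  rw [left_inv_eq_right_inv T.star_koopman_mul T.koopman_mul_inverse, koopman_mul_inverse]

theorem star_koopman_apply_of_eq {ζ ξ : Hilbert} (h : T.koopman ζ = ξ) :
    star T.koopman ξ = ζ := by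
  rw [← h, ← mul_apply_eq_comp, star_koopman_mul]
  rfl

/-- Conjugation by the Koopman unitary implements preimages, so the algebra contains the
characteristic operators of all iterated preimages of the intervals. -/
theorem indOp_preimage (s : Set ℝ) (hs : MeasurableSet s) :
    indOp (T.toFun ⁻¹' s) (T.measurable_toFun hs) = T.koopman * indOp s hs * star T.koopman := by
  rw [koopman_indOp, mul_assoc, koopman_mul_star, mul_one]

/-- A closed `*`-subalgebra that contains the generators contains the C*-algebra. -/
theorem cstarAlgebra_le {S : StarSubalgebra ℂ (Hilbert →L[ℂ] Hilbert)}
    (hS : IsClosed (S : Set (Hilbert →L[ℂ] Hilbert))) (hu : T.koopman ∈ S)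
    (hc : ∀ i, T.charOp i ∈ S) : T.cstarAlgebra ≤ S := by
  refine StarSubalgebra.topologicalClosure_minimal (StarAlgebra.adjoin_le ?_) hS
  rintro a (rfl | ⟨i, rfl⟩)
  · exact star_mem hu
  · exact hc i

theorem koopman_mem : T.koopman ∈ T.cstarAlgebra := by
  have h : T.unitaryOp ∈ T.cstarAlgebra := StarSubalgebra.le_topologicalClosure _
    (StarAlgebra.subset_adjoin ℂ _ (Set.mem_insert _ _))
  have h2 := star_mem h
  rwa [show star T.unitaryOp = T.koopman from star_star T.koopman] at h2

theorem charOp_mem (i : Fin n) : T.charOp i ∈ T.cstarAlgebra :=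
  StarSubalgebra.le_topologicalClosure _
    (StarAlgebra.subset_adjoin ℂ _ (Set.mem_insert_of_mem _ (Set.mem_range_self i)))

/-- The operators that leave a subspace invariant, together with their adjoints. -/
def invariantOps (W : Submodule ℂ Hilbert) : StarSubalgebra ℂ (Hilbert →L[ℂ] Hilbert) where
  carrier := {a | ∀ w ∈ W, a w ∈ W ∧ star a w ∈ W}
  mul_mem' {a b} ha hb w hw := by
    rw [star_mul]
    exact ⟨(ha _ (hb w hw).1).1, (hb _ (ha w hw).2).2⟩
  add_mem' {a b} ha hb w hw := by
    rw [star_add]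
    exact ⟨W.add_mem (ha w hw).1 (hb w hw).1, W.add_mem (ha w hw).2 (hb w hw).2⟩
  algebraMap_mem' c w hw := by
    rw [Algebra.algebraMap_eq_smul_one, star_smul, star_one]
    exact ⟨W.smul_mem _ hw, W.smul_mem _ hw⟩
  star_mem' {a} ha w hw := by
    rw [star_star]
    exact (ha w hw).symm

theorem isClosed_invariantOps {W : Submodule ℂ Hilbert} (hW : IsClosed (W : Set Hilbert)) :
    IsClosed (invariantOps W : Set (Hilbert →L[ℂ] Hilbert)) := by
  have : (invariantOps W : Set (Hilbert →L[ℂ] Hilbert)) =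
      ⋂ w ∈ W, ({a : Hilbert →L[ℂ] Hilbert | a w ∈ (W : Set Hilbert)} ∩
        {a : Hilbert →L[ℂ] Hilbert | star a w ∈ (W : Set Hilbert)}) := by
    ext a
    simp only [Set.mem_iInter]
    exact Iff.rfl
  rw [this]
  refine isClosed_biInter fun w _ => IsClosed.inter ?_ ?_
  · exact hW.preimage (by fun_prop : Continuous fun a : Hilbert →L[ℂ] Hilbert => a w)
  · exact hW.preimage ((by fun_prop : Continuous fun a : Hilbert →L[ℂ] Hilbert => a w).comp
      continuous_star)

variable {T}

/-- The C*-algebra of a stationary transformation has no finite-dimensional reducing subspace. -/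
theorem IsStationary.eq_bot_of_invariant (hn : 2 ≤ n) (hT : T.IsStationary)
    (W : Submodule ℂ Hilbert) [FiniteDimensional ℂ W] (hu : T.koopman ∈ invariantOps W)
    (hc : ∀ i, T.charOp i ∈ invariantOps W) : W = ⊥ := by
  have hle := T.cstarAlgebra_le (isClosed_invariantOps W.closed_of_finiteDimensional) hu hc
  let ρ : T.cstarAlgebra →+* Module.End ℂ W :=
    { toFun := fun a => (a : Hilbert →L[ℂ] Hilbert).toLinearMap.restrict
        fun w hw => (hle a.2 w hw).1
      map_one' := rfl
      map_mul' := fun _ _ => rfl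
      map_zero' := rfl
      map_add' := fun _ _ => rfl }
  exact Submodule.finrank_eq_zero.1 (hT.finrank_eq_zero hn ρ)

/-! ### Infinite itineraries have null cells. -/

variable (T)

/-- The points whose itinerary is coded by `c`. -/
def cell (c : ℕ → Fin n → Prop) : Set ℝ :=
  {x | ∀ k i, T.toFun^[k] x ∈ T.interval i ↔ c k i}

theorem measurableSet_cell (c : ℕ → Fin n → Prop) : MeasurableSet (T.cell c) := by
  simp only [cell, Set.ofPred_forall]
  refine MeasurableSet.iInter fun k => MeasurableSet.iInter fun i => ?_
  refine MeasurableSet.iff ?_ (MeasurableSet.const _)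
  exact T.measurable_toFun.iterate k (T.measurableSet_interval i)

theorem cell_subset (c : ℕ → Fin n → Prop) :
    T.cell c ⊆ T.toFun ⁻¹' T.cell fun k => c (k + 1) := fun _ hx k i => by
  rw [← Function.iterate_succ_apply]
  exact hx (k + 1) i

theorem disjoint_cell {c d : ℕ → Fin n → Prop} (h : c ≠ d) : Disjoint (T.cell c) (T.cell d) := by
  refine Set.disjoint_left.2 fun x hx hx' => h ?_
  funext k i
  exact propext ((hx k i).symm.trans (hx' k i))

variable {T}

/-- The cells of the shifted codes have non-decreasing measure, so if the first one is not null,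
finiteness of the measure makes two shifts coincide. From there on the cells repeat periodically and
the unitary permutes their characteristic vectors cyclically, while each interval's characteristic
operator fixes or kills each of them. Their span would be a non-zero finite-dimensional reducing
subspace. -/
theorem IsStationary.lebesgue_cell (hn : 2 ≤ n) (hT : T.IsStationary) (c : ℕ → Fin n → Prop) :
    lebesgue (T.cell c) = 0 := by
  by_contra hne
  let J : ℕ → Set ℝ := fun m => T.cell fun k => c (k + m)
  have hJm : ∀ m, MeasurableSet (J m) := fun m => T.measurableSet_cell _
  have hsub : ∀ m, J m ⊆ T.toFun ⁻¹' J (m + 1) := fun m => by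
    refine (T.cell_subset _).trans_eq ?_
    simp only [J, add_right_comm, add_assoc]
  have hmono : Monotone fun m => lebesgue (J m) := monotone_nat_of_le_succ fun m =>
    (measure_mono (hsub m)).trans_eq
      (T.measurePreserving.measure_preimage (hJm _).nullMeasurableSet)
  have hpos : ∀ m, lebesgue (J m) ≠ 0 := fun m => by
    have h := hmono (Nat.zero_le m)
    exact (lt_of_lt_of_le (pos_iff_ne_zero.2 hne) h).ne'
  -- Distinct codes have disjoint cells; infinitely many of them, each at least as large as the
  -- first, do not fit into a probability space.
  obtain ⟨p, q, hpq, heq⟩ : ∃ p q, p < q ∧ (fun k => c (k + p)) = fun k => c (k + q) := by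
    by_contra! hinj
    have hdis : Pairwise fun a b => Disjoint (J a) (J b) := fun a b hab => by
      rcases lt_or_gt_of_ne hab with h | h
      · exact T.disjoint_cell (hinj a b h)
      · exact (T.disjoint_cell (hinj b a h)).symm
    have h1 : ∑' m, lebesgue (J m) ≤ 1 := by
      rw [← measure_iUnion hdis hJm]
      exact prob_le_one
    have h2 : ∑' _ : ℕ, lebesgue (J 0) ≤ 1 :=
      (ENNReal.tsum_le_tsum fun m => hmono (Nat.zero_le m)).trans h1
    rw [ENNReal.tsum_const_eq_top_of_ne_zero (hpos 0)] at h2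
    simp at h2
  have hper : ∀ m, J (p + m + (q - p)) = J (p + m) := fun m => by
    have h : ∀ k, c (k + p) = c (k + q) := fun k => congrFun heq k
    simp only [J]
    congr 1
    funext k
    rw [show k + (p + m + (q - p)) = k + m + q by omega, ← h, show k + m + p = k + (p + m) by ring]
  -- Measures that are both monotone and periodic are constant, so the inclusion of `hsub` is an
  -- equality up to a null set.
  have hconst : ∀ m, T.toFun ⁻¹' J (p + m + 1) =ᵐ[lebesgue] J (p + m) := fun m => by
    refine (ae_eq_of_subset_of_measure_ge (hsub _) ?_ (hJm _).nullMeasurableSet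
      (measure_ne_top _ _)).symm
    rw [T.measurePreserving.measure_preimage (hJm _).nullMeasurableSet, ← hper m]
    exact hmono (by omega)
  let v : ℕ → Hilbert := fun m => indVec (J (p + m)) (hJm _)
  have hv : Function.Periodic v (q - p) := fun m => by
    simp only [v]
    congr 1
    rw [← add_assoc, hper]
  have hUv : ∀ m, T.koopman (v (m + 1)) = v m := fun m =>
    (T.koopman_indVec _ _).trans (indVec_congr (hconst m))
  have hfin : (Set.range v).Finite := by
    refine ((Set.finite_Iio (q - p)).image v).subset ?_
    rintro _ ⟨m, rfl⟩
    exact ⟨m % (q - p), Nat.mod_lt _ (by omega), hv.map_mod_nat m⟩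
  let W := Submodule.span ℂ (Set.range v)
  have : FiniteDimensional ℂ W := FiniteDimensional.span_of_finite ℂ hfin
  have hext : ∀ a : Hilbert →L[ℂ] Hilbert, (∀ m, a (v m) ∈ W) → ∀ w ∈ W, a w ∈ W := by
    intro a ha w hw
    have : W ≤ W.comap a.toLinearMap := by
      refine Submodule.span_le.2 ?_
      rintro _ ⟨m, rfl⟩
      exact ha m
    exact this hw
  have hvW : ∀ m, v m ∈ W := fun m => Submodule.subset_span ⟨m, rfl⟩
  have hbot : W = ⊥ := by
    refine hT.eq_bot_of_invariant hn W ?_ fun i => ?_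
    · refine fun w hw => ⟨hext _ (fun m => ?_) w hw, hext _ (fun m => ?_) w hw⟩
      -- The unitary lowers the index by one; a full period is added first so that a predecessor
      -- exists even for `m = 0`.
      · rw [← hv m, show m + (q - p) = (m + (q - p) - 1) + 1 by omega, hUv]
        exact hvW _
      · rw [T.star_koopman_apply_of_eq (hUv m)]
        exact hvW _
    · have h : ∀ w ∈ W, T.charOp i w ∈ W := hext _ fun m => by
        rw [charOp_eq, indOp_indVec]
        by_cases hc : c (p + m) i
        · have : T.interval i ∩ J (p + m) = J (p + m) := Set.inter_eq_right.2 fun x hx => by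
            exact (hx 0 i).2 (by simpa using hc)
          simp only [this]
          exact hvW m
        · have : T.interval i ∩ J (p + m) = ∅ := Set.eq_empty_of_forall_notMem fun x hx =>
            hc (by simpa using (hx.2 0 i).1 hx.1)
          simp only [this]
          rw [show indVec ∅ MeasurableSet.empty = 0 from indicatorConstLp_empty]
          exact W.zero_mem
      intro w hw
      have hstar : star (T.charOp i) = T.charOp i := isSelfAdjoint_indOp _ _
      rw [hstar]
      exact ⟨h w hw, h w hw⟩
  have h0 : v 0 = 0 := by
    have := hvW 0
    rwa [hbot, Submodule.mem_bot] at this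
  exact indVec_ne_zero (hpos _) h0

end IntervalExchange

/-! ### States on operators obtained from measures by local averaging. -/

namespace IntervalExchange

open Filter Topology

/-- The characteristic function of a short interval at `x`, which is one-sided if `r = 0` and
symmetric if `r = 1`. -/
noncomputable def probe (r h x : ℝ) : Hilbert :=
  indVec (Set.Ioo (x - r * h) (x + h)) measurableSet_Ioo

/-- Moving the centre changes the interval only within two segments of length `|y - x|`. Continuity
is what makes the averages measurable for an arbitrary Borel measure, even one singular to Lebesgue
measure. -/
theorem continuous_probe (r h : ℝ) : Continuous (probe r h) := by
  refine continuous_indicatorConstLp_set (hs := fun _ => measurableSet_Ioo)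
    (hμs := fun _ => measure_ne_top _ _) (by simp) fun x => ?_
  have hle : ∀ y, lebesgue (symmDiff (Set.Ioo (y - r * h) (y + h)) (Set.Ioo (x - r * h) (x + h)))
      ≤ ENNReal.ofReal |y - x| + ENNReal.ofReal |y - x| := by
    intro y
    have hsub : symmDiff (Set.Ioo (y - r * h) (y + h)) (Set.Ioo (x - r * h) (x + h)) ⊆
        Set.uIcc (x - r * h) (y - r * h) ∪ Set.uIcc (x + h) (y + h) := by
      rintro z (⟨⟨h1, h2⟩, h3⟩ | ⟨⟨h1, h2⟩, h3⟩)
      · rw [Set.mem_Ioo, not_and_or, not_lt, not_lt] at h3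
        rcases h3 with h3 | h3
        · exact Or.inl (Set.mem_uIcc.2 (Or.inr ⟨h1.le, h3⟩))
        · exact Or.inr (Set.mem_uIcc.2 (Or.inl ⟨h3, h2.le⟩))
      · rw [Set.mem_Ioo, not_and_or, not_lt, not_lt] at h3
        rcases h3 with h3 | h3
        · exact Or.inl (Set.mem_uIcc.2 (Or.inl ⟨h1.le, h3⟩))
        · exact Or.inr (Set.mem_uIcc.2 (Or.inr ⟨h3, h2.le⟩))
    refine (measure_mono hsub).trans ((Measure.restrict_apply_le _ _).trans
      ((measure_union_le _ _).trans_eq ?_))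
    rw [Real.volume_interval, Real.volume_interval]
    congr 3 <;> ring
  refine tendsto_of_tendsto_of_tendsto_of_le_of_le tendsto_const_nhds ?_ (fun _ => zero_le) hle
  have : Continuous fun y : ℝ => ENNReal.ofReal |y - x| + ENNReal.ofReal |y - x| :=
    (ENNReal.continuous_ofReal.comp (by fun_prop)).add
      (ENNReal.continuous_ofReal.comp (by fun_prop))
  simpa using this.tendsto x

/-- The normalized matrix coefficient of an operator at a short interval. -/
noncomputable def avg (r h : ℝ) (a : Hilbert →L[ℂ] Hilbert) (x : ℝ) : ℂ :=
  (((1 + r) * h : ℝ) : ℂ)⁻¹ * inner ℂ (probe r h x) (a (probe r h x))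

theorem continuous_avg (r h : ℝ) (a : Hilbert →L[ℂ] Hilbert) : Continuous (avg r h a) :=
  continuous_const.mul ((continuous_probe r h).inner (a.continuous.comp (continuous_probe r h)))

theorem norm_probe_sq_le {r h : ℝ} (hr : 0 ≤ r) (hh : 0 < h) (x : ℝ) :
    ‖probe r h x‖ ^ 2 ≤ (1 + r) * h := by
  rw [probe, norm_indVec_sq, measureReal_def]
  refine ENNReal.toReal_le_of_le_ofReal (by positivity) ?_
  refine (Measure.restrict_apply_le _ _).trans_eq ?_
  rw [Real.volume_Ioo]
  congr 1
  ring

theorem norm_avg_le {r h : ℝ} (hr : 0 ≤ r) (hh : 0 < h) (a : Hilbert →L[ℂ] Hilbert) (x : ℝ) :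
    ‖avg r h a x‖ ≤ ‖a‖ := by
  have hpos : 0 < (1 + r) * h := by positivity
  rw [avg, norm_mul, norm_inv, Complex.norm_real, Real.norm_of_nonneg hpos.le,
    inv_mul_le_iff₀ hpos]
  calc ‖inner ℂ (probe r h x) (a (probe r h x))‖ ≤ ‖probe r h x‖ * ‖a (probe r h x)‖ :=
        norm_inner_le_norm _ _
    _ ≤ ‖probe r h x‖ * (‖a‖ * ‖probe r h x‖) := by gcongr; exact a.le_opNorm _
    _ = ‖probe r h x‖ ^ 2 * ‖a‖ := by ring
    _ ≤ (1 + r) * h * ‖a‖ := by gcongr; exact norm_probe_sq_le hr hh x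

theorem integrable_avg (μ : Measure ℝ) [IsProbabilityMeasure μ] {r h : ℝ} (hr : 0 ≤ r)
    (hh : 0 < h) (a : Hilbert →L[ℂ] Hilbert) : Integrable (avg r h a) μ :=
  Integrable.of_bound (continuous_avg r h a).aestronglyMeasurable ‖a‖
    (ae_of_all _ (norm_avg_le hr hh a))

/-- A sequence of positive numbers tending to zero. -/
noncomputable def mesh (m : ℕ) : ℝ := 1 / (m + 1)

theorem mesh_pos (m : ℕ) : 0 < mesh m := by unfold mesh; positivity

theorem tendsto_mesh : Tendsto mesh atTop (𝓝[>] 0) :=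
  tendsto_nhdsWithin_iff.2 ⟨tendsto_one_div_add_atTop_nhds_zero_nat, Eventually.of_forall mesh_pos⟩

theorem norm_integral_avg_le (μ : Measure ℝ) [IsProbabilityMeasure μ] {r : ℝ} (hr : 0 ≤ r)
    (m : ℕ) (a : Hilbert →L[ℂ] Hilbert) :
    ‖∫ x, avg r (mesh m) a x ∂μ‖ ≤ ‖a‖ := by
  refine (norm_integral_le_of_norm_le_const
    (ae_of_all _ (norm_avg_le hr (mesh_pos m) a))).trans_eq ?_
  simp

/-- The averages are bounded, but for a general operator they need not converge as the length
shrinks. A limit along a fixed ultrafilter always exists and is linear in the operator. -/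
theorem exists_tendsto_avg (μ : Measure ℝ) [IsProbabilityMeasure μ] {r : ℝ} (hr : 0 ≤ r)
    (a : Hilbert →L[ℂ] Hilbert) : ∃ z, Tendsto
    (fun m => ∫ x, avg r (mesh m) a x ∂μ) (hyperfilter ℕ : Filter ℕ) (𝓝 z) := by
  have h := (isCompact_closedBall (0 : ℂ) ‖a‖).ultrafilter_le_nhds
    ((hyperfilter ℕ).map fun m => ∫ x, avg r (mesh m) a x ∂μ) (by
      rw [le_principal_iff, Ultrafilter.mem_coe]
      exact Ultrafilter.mem_map.2 (univ_mem' fun m => by simpa using norm_integral_avg_le μ hr m a))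
  obtain ⟨z, -, hz⟩ := h
  exact ⟨z, hz⟩

section state

variable {r : ℝ} (hr : 0 ≤ r) (μ : Measure ℝ) [IsProbabilityMeasure μ]

/-- The state on the operators on `L²` given by an ultrafilter limit of local averages. -/
noncomputable def state : (Hilbert →L[ℂ] Hilbert) →L[ℂ] ℂ :=
  LinearMap.mkContinuous
    { toFun := fun a => (exists_tendsto_avg μ hr a).choose
      map_add' := fun a b => by
        refine tendsto_nhds_unique (exists_tendsto_avg μ hr (a + b)).choose_spec ?_
        refine ((exists_tendsto_avg μ hr a).choose_spec.add
          (exists_tendsto_avg μ hr b).choose_spec).congr fun m => ?_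
        rw [← integral_add (integrable_avg μ hr (mesh_pos m) a)
          (integrable_avg μ hr (mesh_pos m) b)]
        simp only [avg, add_apply, inner_add_right, mul_add]
      map_smul' := fun c a => by
        refine tendsto_nhds_unique (exists_tendsto_avg μ hr (c • a)).choose_spec ?_
        refine ((exists_tendsto_avg μ hr a).choose_spec.const_mul c).congr fun m => ?_
        rw [← integral_const_mul]
        simp only [avg, smul_apply, inner_smul_right, mul_left_comm c] }
    1 fun a => by
      rw [one_mul]
      exact le_of_tendsto (exists_tendsto_avg μ hr a).choose_spec.norm
        (Eventually.of_forall fun m => norm_integral_avg_le μ hr m a)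

theorem tendsto_state (a : Hilbert →L[ℂ] Hilbert) : Tendsto
    (fun m => ∫ x, avg r (mesh m) a x ∂μ) (hyperfilter ℕ : Filter ℕ) (𝓝 (state hr μ a)) :=
  (exists_tendsto_avg μ hr a).choose_spec

theorem state_star (a : Hilbert →L[ℂ] Hilbert) :
    state hr μ (star a) = (starRingEnd ℂ) (state hr μ a) := by
  refine tendsto_nhds_unique (tendsto_state hr μ (star a)) ?_
  refine ((Complex.continuous_conj.tendsto _).comp (tendsto_state hr μ a)).congr fun m => ?_
  rw [Function.comp_apply, ← integral_conj]
  refine integral_congr_ae (ae_of_all _ fun x => ?_)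
  simp only [avg, map_mul, map_inv₀, Complex.conj_ofReal, inner_conj_symm]
  rw [ContinuousLinearMap.star_eq_adjoint, ContinuousLinearMap.adjoint_inner_right]

theorem state_nonneg (a : Hilbert →L[ℂ] Hilbert) : 0 ≤ (state hr μ (star a * a)).re := by
  refine ge_of_tendsto ((Complex.continuous_re.tendsto _).comp (tendsto_state hr μ (star a * a)))
    (Eventually.of_forall fun m => ?_)
  have h : ∀ x, avg r (mesh m) (star a * a) x =
      (((1 + r) * mesh m)⁻¹ * ‖a (probe r (mesh m) x)‖ ^ 2 : ℝ) := fun x => by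
    rw [avg, mul_apply_eq_comp, ContinuousLinearMap.star_eq_adjoint,
      ContinuousLinearMap.adjoint_inner_right, inner_self_eq_norm_sq_to_K]
    push_cast
    rfl
  simp only [Function.comp_apply, h, integral_complex_ofReal, Complex.ofReal_re]
  have := mesh_pos m
  exact integral_nonneg fun x => by positivity

/-- By dominated convergence the integrals have an ordinary limit, so the choice of ultrafilter is
immaterial for such operators. -/
theorem state_eq_integral {a : Hilbert →L[ℂ] Hilbert} {g : ℝ → ℂ}
    (h : ∀ᵐ x ∂μ, ∀ᶠ t in 𝓝[>] 0, avg r t a x = g x) : state hr μ a = ∫ x, g x ∂μ := by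
  refine tendsto_nhds_unique (tendsto_state hr μ a)
    (Tendsto.mono_left ?_ Nat.hyperfilter_le_atTop)
  refine tendsto_integral_of_dominated_convergence (fun _ => ‖a‖)
    (fun m => (continuous_avg _ _ _).aestronglyMeasurable) (integrable_const _)
    (fun m => ae_of_all _ (norm_avg_le hr (mesh_pos m) a)) ?_
  filter_upwards [h] with x hx
  exact tendsto_const_nhds.congr' ((tendsto_mesh.eventually hx).mono fun m hm => hm.symm)

/-- Neither family of averages has to converge pointwise, but their difference after the
substitution `ψ` is eventually zero. Dominated convergence applies to that difference, and the
substitution does not change the integral. -/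
theorem state_eq_of_eventuallyEq {a b : Hilbert →L[ℂ] Hilbert} {ψ : ℝ → ℝ}
    (hψ : MeasurePreserving ψ μ μ)
    (h : ∀ᵐ x ∂μ, ∀ᶠ t in 𝓝[>] 0, avg r t a x = avg r t b (ψ x)) :
    state hr μ a = state hr μ b := by
  have hbψ : ∀ m, Integrable (fun x => avg r (mesh m) b (ψ x)) μ := fun m =>
    hψ.integrable_comp_of_integrable (integrable_avg μ hr (mesh_pos m) b)
  have h1 := (tendsto_state hr μ a).sub (tendsto_state hr μ b)
  have h2 : Tendsto (fun m => ∫ x, (avg r (mesh m) a x - avg r (mesh m) b (ψ x)) ∂μ) atTop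
      (𝓝 (∫ _, (0 : ℂ) ∂μ)) := by
    refine tendsto_integral_of_dominated_convergence (fun _ => ‖a‖ + ‖b‖)
      (fun m => ((integrable_avg μ hr (mesh_pos m) a).sub (hbψ m)).aestronglyMeasurable)
      (integrable_const _)
      (fun m => ae_of_all _ fun x => (norm_sub_le _ _).trans
        (add_le_add (norm_avg_le hr (mesh_pos m) a _) (norm_avg_le hr (mesh_pos m) b _))) ?_
    filter_upwards [h] with x hx
    refine tendsto_const_nhds.congr' ((tendsto_mesh.eventually hx).mono fun m hm => ?_)
    exact (sub_eq_zero.2 hm).symm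
  rw [integral_zero] at h2
  refine sub_eq_zero.1 (tendsto_nhds_unique h1 ((h2.mono_left Nat.hyperfilter_le_atTop).congr
    fun m => ?_))
  rw [integral_sub (integrable_avg μ hr (mesh_pos m) a) (hbψ m)]
  congr 1
  have h3 := integral_map (μ := μ) hψ.measurable.aemeasurable
    (continuous_avg r (mesh m) b).aestronglyMeasurable
  rw [hψ.map_eq] at h3
  exact h3.symm

end state

/-! ### Regular points and the trace property. -/

variable {n : ℕ} (T : IntervalExchange n)

/-- The transformation moves short intervals at `x` to short intervals at its image. -/
def IsRegular (r x : ℝ) : Prop :=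
  ∃ i, x ∈ T.interval i ∧ ∀ᶠ h in 𝓝[>] 0, Set.Ioo (x - r * h) (x + h) ⊆ T.interval i ∧
    T.koopman (probe r h (T.toFun x)) = probe r h x

theorem interval_subset (i : Fin n) : T.interval i ⊆ Set.Ico 0 1 :=
  T.iUnion_interval ▸ Set.subset_iUnion _ i

theorem disjoint_interval {i j : Fin n} (h : i ≠ j) : Disjoint (T.interval i) (T.interval j) :=
  (start_tiling T.len T.len_pos).2 h

theorem lebesgue_Ioo {i : Fin n} {a b : ℝ} (h : Set.Ioo a b ⊆ T.interval i) :
    lebesgue (Set.Ioo a b) = ENNReal.ofReal (b - a) := by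
  rw [lebesgue, Measure.restrict_apply measurableSet_Ioo,
    Set.inter_eq_left.2 (h.trans (T.interval_subset i)), Real.volume_Ioo]

/-- A translation preserves one-sided intervals, which fit even at a left endpoint. A reflection
exchanges the sides, so flips require symmetric intervals and hence an interior point. -/
theorem isRegular_of_mem {r x : ℝ} {i : Fin n} (hx : x ∈ T.interval i)
    (hr : (r = 0 ∧ T.sign i = 1) ∨ (r = 1 ∧ x ≠ T.left i)) : T.IsRegular r x := by
  refine ⟨i, hx, ?_⟩
  have hr0 : 0 ≤ r := by rcases hr with ⟨h, -⟩ | ⟨h, -⟩ <;> simp [h]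
  have hev : ∀ᶠ h in 𝓝[>] (0 : ℝ), 0 < h ∧ Set.Ioo (x - r * h) (x + h) ⊆ T.interval i := by
    obtain ⟨δ, hδ, hδ2⟩ : ∃ δ > 0, ∀ h < δ, T.left i ≤ x - r * h ∧ x + h ≤ T.left i + T.len i := by
      rcases hr with ⟨rfl, -⟩ | ⟨rfl, hne⟩
      · exact ⟨T.left i + T.len i - x, sub_pos.2 hx.2, fun h hh =>
          ⟨by linarith [hx.1], by linarith⟩⟩
      · refine ⟨min (T.left i + T.len i - x) (x - T.left i), lt_min (sub_pos.2 hx.2)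
          (sub_pos.2 (lt_of_le_of_ne hx.1 hne.symm)), fun h hh => ?_⟩
        have := lt_min_iff.1 hh
        exact ⟨by linarith, by linarith⟩
    filter_upwards [Ioo_mem_nhdsGT hδ] with h hh
    refine ⟨hh.1, fun y hy => ?_⟩
    have := hδ2 h hh.2
    exact ⟨by linarith [hy.1], by linarith [hy.2]⟩
  filter_upwards [hev] with h ⟨hh, hsub⟩
  refine ⟨hsub, ?_⟩
  rw [probe, koopman_indVec, probe]
  -- Only one inclusion is checked pointwise; since the map preserves Lebesgue measure, the
  -- comparison of lengths gives equality up to a null set.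
  refine indVec_congr (ae_eq_of_subset_of_measure_ge ?_ ?_
    measurableSet_Ioo.nullMeasurableSet (measure_ne_top _ _)).symm
  · intro y hy
    rw [Set.mem_preimage, T.toFun_eq i hx, T.toFun_eq i (hsub hy)]
    simp only [piece]
    rcases hr with ⟨rfl, hs⟩ | ⟨rfl, -⟩
    · rw [if_pos hs, if_pos hs]
      constructor <;> linarith [hy.1, hy.2]
    · split_ifs
      · constructor <;> linarith [hy.1, hy.2]
      · constructor <;> linarith [hy.1, hy.2]
  · rw [T.measurePreserving.measure_preimage measurableSet_Ioo.nullMeasurableSet,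
      T.lebesgue_Ioo hsub]
    refine (Measure.restrict_apply_le _ _).trans_eq ?_
    rw [Real.volume_Ioo]
    congr 1
    ring

/-- With flips, symmetric intervals work because invariant measures are required not to charge
endpoints. Without flips endpoints may be charged, and one-sided intervals are used. The choice
depends on `T` only, so different measures can be compared with the same `r`. -/
theorem exists_ae_isRegular : ∃ r : ℝ, 0 ≤ r ∧
    ∀ μ : Measure ℝ, T.IsInvariant μ → ∀ᵐ x ∂μ, T.IsRegular r x := by
  by_cases h : ∃ i, T.sign i = -1
  · refine ⟨1, zero_le_one, fun μ hμ => ?_⟩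
    have h1 : ∀ᵐ x ∂μ, ∀ i, x ≠ T.left i := ae_all_iff.2 fun i => by
      simpa [ae_iff] using hμ.endpoints h i
    filter_upwards [h1, mem_ae_iff.2 hμ.carrier] with x hx hx1
    rw [← T.iUnion_interval] at hx1
    obtain ⟨i, hi⟩ := Set.mem_iUnion.1 hx1
    exact T.isRegular_of_mem hi (Or.inr ⟨rfl, hx i⟩)
  · refine ⟨0, le_rfl, fun μ hμ => ?_⟩
    filter_upwards [mem_ae_iff.2 hμ.carrier] with x hx1
    rw [← T.iUnion_interval] at hx1
    obtain ⟨i, hi⟩ := Set.mem_iUnion.1 hx1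
    exact T.isRegular_of_mem hi (Or.inl ⟨rfl,
      (Int.units_eq_one_or (T.sign i)).resolve_right fun h' => h ⟨i, h'⟩⟩)

variable {T}

theorem IsRegular.avg_one {r x : ℝ} (hr : 0 ≤ r) (hx : T.IsRegular r x) :
    ∀ᶠ h in 𝓝[>] 0, avg r h 1 x = 1 := by
  obtain ⟨i, -, hx⟩ := hx
  filter_upwards [hx, self_mem_nhdsWithin] with h ⟨hsub, _⟩ hh
  have hpos : 0 < (1 + r) * h := mul_pos (by linarith) hh
  have hn : ‖probe r h x‖ ^ 2 = (1 + r) * h := by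
    rw [probe, norm_indVec_sq, measureReal_def, T.lebesgue_Ioo hsub,
      ENNReal.toReal_ofReal (by linarith)]
    ring
  rw [avg, one_apply_eq_self, inner_self_eq_norm_sq_to_K]
  have : ((‖probe r h x‖ : ℂ)) ^ 2 = (((1 + r) * h : ℝ) : ℂ) := by exact_mod_cast hn
  change _ * (‖probe r h x‖ : ℂ) ^ 2 = 1
  rw [this, inv_mul_cancel₀ (by exact_mod_cast hpos.ne')]

theorem IsRegular.star_koopman_probe {r x : ℝ} (hx : T.IsRegular r x) :
    ∀ᶠ h in 𝓝[>] 0, star T.koopman (probe r h x) = probe r h (T.toFun x) := by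
  obtain ⟨i, -, hx⟩ := hx
  filter_upwards [hx] with h hh
  exact T.star_koopman_apply_of_eq hh.2

theorem IsRegular.charOp_probe {r x : ℝ} (hx : T.IsRegular r x) (j : Fin n) :
    ∀ᶠ h in 𝓝[>] 0, T.charOp j (probe r h x) =
      (T.interval j).indicator (fun _ => (1 : ℂ)) x • probe r h x := by
  obtain ⟨i, hi, hx⟩ := hx
  filter_upwards [hx] with h ⟨hsub, _⟩
  rw [charOp_eq, probe, indOp_indVec]
  by_cases hij : i = j
  · subst hij
    simp only [Set.inter_eq_right.2 hsub, Set.indicator_of_mem hi, one_smul]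
  · have hd := T.disjoint_interval hij
    have he : T.interval j ∩ Set.Ioo (x - r * h) (x + h) = ∅ :=
      (hd.mono_left hsub).symm.inter_eq
    rw [Set.indicator_of_notMem (Set.disjoint_left.1 hd hi), zero_smul]
    simp only [he]
    exact indicatorConstLp_empty

section trace

variable {r : ℝ} (hr : 0 ≤ r) {μ : Measure ℝ} [IsProbabilityMeasure μ]

theorem state_one (hreg : ∀ᵐ x ∂μ, T.IsRegular r x) : state hr μ 1 = 1 := by
  rw [state_eq_integral hr μ (g := fun _ => 1) (hreg.mono fun x hx => hx.avg_one hr)]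
  simp

/-- The adjoint of the Koopman unitary carries the probe at `x` to the probe at `T.toFun x`, so
conjugation shifts the averages along the orbit, and invariance of `μ` absorbs the shift. -/
theorem state_conj_koopman (hμ : T.IsInvariant μ) (hreg : ∀ᵐ x ∂μ, T.IsRegular r x)
    (a : Hilbert →L[ℂ] Hilbert) :
    state hr μ (T.koopman * a * star T.koopman) = state hr μ a := by
  refine state_eq_of_eventuallyEq hr μ hμ.preserving ?_
  filter_upwards [hreg] with x hx
  filter_upwards [hx.star_koopman_probe] with h hh
  have e : inner ℂ (probe r h x) (T.koopman (a (star T.koopman (probe r h x)))) =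
      inner ℂ (star T.koopman (probe r h x)) (a (star T.koopman (probe r h x))) := by
    rw [ContinuousLinearMap.star_eq_adjoint, ContinuousLinearMap.adjoint_inner_left]
  rw [avg, mul_apply_eq_comp, mul_apply_eq_comp, e, hh]
  rfl

/-- A short probe is an eigenvector, with eigenvalue `0` or `1`, of the self-adjoint operator
`T.charOp i`, so both products have the same average. -/
theorem state_mul_charOp (hreg : ∀ᵐ x ∂μ, T.IsRegular r x) (i : Fin n)
    (a : Hilbert →L[ℂ] Hilbert) :
    state hr μ (a * T.charOp i) = state hr μ (T.charOp i * a) := by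
  refine state_eq_of_eventuallyEq hr μ (MeasurePreserving.id μ) ?_
  filter_upwards [hreg] with x hx
  filter_upwards [hx.charOp_probe i] with h hh
  have hsym : ContinuousLinearMap.adjoint (T.charOp i) = T.charOp i := isSelfAdjoint_indOp _ _
  have e : inner ℂ (probe r h x) (T.charOp i (a (probe r h x))) =
      inner ℂ (T.charOp i (probe r h x)) (a (probe r h x)) := by
    conv_rhs => rw [← hsym]
    rw [ContinuousLinearMap.adjoint_inner_left]
  rw [id, avg, avg, mul_apply_eq_comp, mul_apply_eq_comp, e, hh, map_smul, inner_smul_left,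
    inner_smul_right]
  by_cases hxi : x ∈ T.interval i <;> simp [hxi]

/-- The operators that commute with all operators under a state. -/
def centralizerOps (τ : (Hilbert →L[ℂ] Hilbert) →L[ℂ] ℂ)
    (hτ : ∀ a, τ (star a) = (starRingEnd ℂ) (τ a)) :
    StarSubalgebra ℂ (Hilbert →L[ℂ] Hilbert) where
  carrier := {b | ∀ a, τ (a * b) = τ (b * a)}
  mul_mem' {b c} hb hc a := by rw [← mul_assoc, hc, ← mul_assoc, hb, mul_assoc]
  add_mem' {b c} hb hc a := by rw [mul_add, add_mul, map_add, map_add, hb, hc]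
  algebraMap_mem' c a := by rw [Algebra.commutes]
  star_mem' {b} hb a := by
    have h : ∀ a, τ (star a * star b) = τ (star b * star a) := fun a => by
      rw [← star_mul, ← star_mul, hτ, hτ, hb]
    simpa using h (star a)

theorem isClosed_centralizerOps (τ : (Hilbert →L[ℂ] Hilbert) →L[ℂ] ℂ)
    (hτ : ∀ a, τ (star a) = (starRingEnd ℂ) (τ a)) :
    IsClosed (centralizerOps τ hτ : Set (Hilbert →L[ℂ] Hilbert)) := by
  have : (centralizerOps τ hτ : Set (Hilbert →L[ℂ] Hilbert)) =
      ⋂ a, {b : Hilbert →L[ℂ] Hilbert | τ (a * b) = τ (b * a)} := by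
    ext b
    simp only [Set.mem_iInter]
    exact Iff.rfl
  rw [this]
  exact isClosed_iInter fun a => isClosed_eq (by fun_prop) (by fun_prop)

/-- The state given by an invariant measure is a trace on the C*-algebra. -/
theorem state_mul_comm (hμ : T.IsInvariant μ) (hreg : ∀ᵐ x ∂μ, T.IsRegular r x)
    {b : Hilbert →L[ℂ] Hilbert} (hb : b ∈ T.cstarAlgebra) (a : Hilbert →L[ℂ] Hilbert) :
    state hr μ (a * b) = state hr μ (b * a) := by
  refine T.cstarAlgebra_le (isClosed_centralizerOps (state hr μ) (state_star hr μ)) ?_ ?_ hb a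
  · intro a
    -- Conjugating `a * T.koopman` by the unitary yields `T.koopman * a`.
    rw [← state_conj_koopman hr hμ hreg, ← mul_assoc, mul_assoc, koopman_mul_star, mul_one]
  · exact fun i a => state_mul_charOp hr hreg i a

/-- The real-valued trace on the C*-algebra given by an invariant measure. -/
noncomputable def realTrace (T : IntervalExchange n) {r : ℝ} (hr : 0 ≤ r) (μ : Measure ℝ)
    [IsProbabilityMeasure μ] : T.cstarAlgebra →+ ℝ :=
  Complex.reLm.toAddMonoidHom.comp
    ((state hr μ).toLinearMap.toAddMonoidHom.comp T.cstarAlgebra.subtype.toAddMonoidHom)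

theorem realTrace_apply (T : IntervalExchange n) (a : T.cstarAlgebra) :
    T.realTrace hr μ a = (state hr μ a).re := rfl

end trace

/-! ### Recovering an invariant measure from its trace. -/

/-- The Boolean algebra of sets generated by the preimages of the intervals. -/
inductive IsClopenSet (T : IntervalExchange n) : Set ℝ → Prop
  | interval (i : Fin n) : IsClopenSet T (T.interval i)
  | compl {s : Set ℝ} : IsClopenSet T s → IsClopenSet T sᶜ
  | inter {s t : Set ℝ} : IsClopenSet T s → IsClopenSet T t → IsClopenSet T (s ∩ t)
  | preimage {s : Set ℝ} : IsClopenSet T s → IsClopenSet T (T.toFun ⁻¹' s)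

namespace IsClopenSet

theorem measurableSet {s : Set ℝ} (h : T.IsClopenSet s) : MeasurableSet s := by
  induction h with
  | interval i => exact T.measurableSet_interval i
  | compl _ ih => exact ih.compl
  | inter _ _ ih ih' => exact ih.inter ih'
  | preimage _ ih => exact T.measurable_toFun ih

theorem indOp_mem {s : Set ℝ} (h : T.IsClopenSet s) : indOp s h.measurableSet ∈ T.cstarAlgebra := by
  induction h with
  | interval i => exact T.charOp_mem i
  | compl h ih =>
    rw [indOp_compl _ h.measurableSet]
    exact sub_mem (one_mem _) ih
  | inter h h' ih ih' =>
    rw [← indOp_mul _ _ h.measurableSet h'.measurableSet]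
    exact mul_mem ih ih'
  | preimage h ih =>
    rw [T.indOp_preimage _ h.measurableSet]
    exact mul_mem (mul_mem T.koopman_mem ih) (star_mem T.koopman_mem)

/-- Short probes do not see the boundary of a clopen set at almost every point. The preimage case
applies the inductive statement at the image point, which is legitimate almost everywhere because
`μ` is invariant. -/
theorem indOp_probe {s : Set ℝ} (hs : T.IsClopenSet s) {r : ℝ} {μ : Measure ℝ}
    (hμ : T.IsInvariant μ) (hreg : ∀ᵐ x ∂μ, T.IsRegular r x) :
    ∀ᵐ x ∂μ, ∀ᶠ h in 𝓝[>] 0, indOp s hs.measurableSet (probe r h x) =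
      s.indicator (fun _ => (1 : ℂ)) x • probe r h x := by
  induction hs with
  | interval i => exact hreg.mono fun x hx => hx.charOp_probe i
  | compl h ih =>
    filter_upwards [ih] with x hx
    filter_upwards [hx] with t ht
    rw [indOp_compl _ h.measurableSet, sub_apply, one_apply_eq_self, ht]
    rename_i s
    by_cases hxs : x ∈ s <;> simp [hxs]
  | inter h h' ih ih' =>
    filter_upwards [ih, ih'] with x hx hx'
    filter_upwards [hx, hx'] with t ht ht'
    rw [← indOp_mul _ _ h.measurableSet h'.measurableSet, mul_apply_eq_comp, ht', map_smul, ht,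
      smul_smul]
    rename_i s s'
    by_cases hxs : x ∈ s <;> by_cases hxs' : x ∈ s' <;> simp [hxs, hxs']
  | preimage h ih =>
    filter_upwards [hreg, hμ.preserving.quasiMeasurePreserving.ae ih] with x hx hx'
    filter_upwards [hx.star_koopman_probe, hx'] with t ht ht'
    rw [T.indOp_preimage _ h.measurableSet, mul_apply_eq_comp, mul_apply_eq_comp, ht, ht',
      map_smul, ← ht, ← mul_apply_eq_comp, koopman_mul_star]
    rfl

theorem state_indOp {s : Set ℝ} (hs : T.IsClopenSet s) {r : ℝ} (hr : 0 ≤ r) {μ : Measure ℝ}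
    [IsProbabilityMeasure μ] (hμ : T.IsInvariant μ) (hreg : ∀ᵐ x ∂μ, T.IsRegular r x) :
    state hr μ (indOp s hs.measurableSet) = μ.real s := by
  rw [state_eq_integral hr μ (g := s.indicator fun _ => 1), integral_indicator hs.measurableSet]
  · simp
  · filter_upwards [hreg, hs.indOp_probe hμ hreg] with x hx hx'
    filter_upwards [hx.avg_one hr, hx'] with t ht ht'
    have : avg r t (indOp s hs.measurableSet) x =
        s.indicator (fun _ => (1 : ℂ)) x * avg r t 1 x := by
      rw [avg, avg, ht', inner_smul_right, one_apply_eq_self]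
      ring
    rw [this, ht, mul_one]

end IsClopenSet

theorem isInvariant_lebesgue (T : IntervalExchange n) : T.IsInvariant lebesgue where
  carrier := by simp [lebesgue, Measure.restrict_apply measurableSet_Ico.compl]
  preserving := T.measurePreserving
  endpoints _ i := by
    refine le_antisymm ((Measure.restrict_apply_le _ _).trans_eq ?_) zero_le
    simp

/-- An invariant measure of a stationary transformation agrees with Lebesgue measure on the
Boolean algebra generated by the preimages of the intervals. -/
theorem IsStationary.measure_eq (hT : T.IsStationary) {μ : Measure ℝ} [IsProbabilityMeasure μ]
    (hμ : T.IsInvariant μ) {s : Set ℝ} (hs : T.IsClopenSet s) : μ s = lebesgue s := by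
  obtain ⟨r, hr, hreg⟩ := T.exists_ae_isRegular
  have key : ∀ (ν : Measure ℝ) [IsProbabilityMeasure ν], T.IsInvariant ν →
      (∀ a b, T.realTrace hr ν (a * b) = T.realTrace hr ν (b * a)) ∧
      (∀ a, 0 ≤ T.realTrace hr ν (star a * a)) ∧ T.realTrace hr ν 1 = 1 := by
    intro ν _ hν
    refine ⟨fun a b => ?_, fun a => state_nonneg hr ν a, ?_⟩
    · exact congrArg Complex.re (state_mul_comm hr hν (hreg ν hν) b.2 a)
    · exact congrArg Complex.re (state_one hr (hreg ν hν))
  obtain ⟨h1, h2, h3⟩ := key μ hμ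
  obtain ⟨h4, h5, h6⟩ := key lebesgue T.isInvariant_lebesgue
  have hp : IsStarProjection (⟨indOp s hs.measurableSet, hs.indOp_mem⟩ : T.cstarAlgebra) := by
    have h := isStarProjection_indOp s hs.measurableSet
    exact ⟨Subtype.ext h.isIdempotentElem, Subtype.ext h.isSelfAdjoint⟩
  have h := hT.trace_unique h1 h4 h2 h5 h3 h6 hp
  rw [realTrace_apply, realTrace_apply, hs.state_indOp hr hμ (hreg μ hμ),
    hs.state_indOp hr T.isInvariant_lebesgue (hreg _ T.isInvariant_lebesgue)] at h
  exact (measureReal_eq_measureReal_iff).1 (by simpa using h)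

end IntervalExchange

/-! ### From clopen sets to half-lines. -/

namespace IntervalExchange

open Filter Topology

variable {n : ℕ} {T : IntervalExchange n}

namespace IsClopenSet

theorem empty (i : Fin n) : T.IsClopenSet ∅ := by
  have h := (interval i (T := T)).inter (interval i).compl
  rwa [Set.inter_compl_self] at h

theorem union {s t : Set ℝ} (hs : T.IsClopenSet s) (ht : T.IsClopenSet t) :
    T.IsClopenSet (s ∪ t) := by
  have h := (hs.compl.inter ht.compl).compl
  rwa [Set.compl_inter, compl_compl, compl_compl] at h

theorem iterate {s : Set ℝ} (hs : T.IsClopenSet s) (k : ℕ) :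
    T.IsClopenSet (T.toFun^[k] ⁻¹' s) := by
  induction k with
  | zero => exact hs
  | succ k ih =>
    rw [Function.iterate_succ, Set.preimage_comp]
    exact ih.preimage

/-- A set that is a union of atoms of finitely many clopen sets is clopen. -/
theorem of_saturated {ι : Type*} [Finite ι] (i₀ : Fin n) {A : ι → Set ℝ}
    (hA : ∀ p, T.IsClopenSet (A p)) {S : Set ℝ}
    (hS : ∀ x ∈ S, ∀ y, (∀ p, x ∈ A p ↔ y ∈ A p) → y ∈ S) : T.IsClopenSet S := by
  have := Fintype.ofFinite ι
  have hfib : ∀ c : ι → Prop, T.IsClopenSet {y | ∀ p, y ∈ A p ↔ c p} := by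
    intro c
    have h : ∀ s : Finset ι, T.IsClopenSet {y | ∀ p ∈ s, (y ∈ A p ↔ c p)} := by
      classical
      intro s
      induction s using Finset.induction_on with
      | empty => simpa using! (empty i₀ (T := T)).compl
      | insert a s _ ih =>
        have e : {y | ∀ p ∈ insert a s, (y ∈ A p ↔ c p)} =
            {y | y ∈ A a ↔ c a} ∩ {y | ∀ p ∈ s, (y ∈ A p ↔ c p)} := by
          ext y
          exact Finset.forall_mem_insert a s _
        rw [e]
        refine inter ?_ ih
        by_cases hc : c a
        · simpa [hc] using hA a
        · simpa [hc] using! (hA a).compl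
    simpa using h Finset.univ
  -- A saturated set is the preimage of its set of codes, and there are only finitely many codes.
  let code : ℝ → ι → Prop := fun x p => x ∈ A p
  have hpre : ∀ F : Set (ι → Prop), F.Finite → T.IsClopenSet (code ⁻¹' F) := by
    intro F hF
    induction F, hF using Set.Finite.induction_on with
    | empty => exact empty i₀
    | @insert c F _ _ ih =>
      rw [Set.insert_eq, Set.preimage_union]
      refine union ?_ ih
      convert hfib c using 1
      ext y
      exact ⟨fun h p => iff_of_eq (congrFun h p), fun h => funext fun p => propext (h p)⟩
  convert hpre (code '' S) (Set.toFinite _) using 1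
  ext y
  refine ⟨fun h => ⟨y, h, rfl⟩, ?_⟩
  rintro ⟨x, hx, hxy⟩
  exact hS x hx y fun p => iff_of_eq (congrFun hxy p)

end IsClopenSet

/-- Two points lie in the same intervals up to time `N`. -/
def SameCode (T : IntervalExchange n) (N : ℕ) (x y : ℝ) : Prop :=
  ∀ k < N, ∀ i, T.toFun^[k] x ∈ T.interval i ↔ T.toFun^[k] y ∈ T.interval i

theorem SameCode.symm {N : ℕ} {x y : ℝ} (h : T.SameCode N x y) : T.SameCode N y x :=
  fun k hk i => (h k hk i).symm

theorem SameCode.trans {N : ℕ} {x y z : ℝ} (h : T.SameCode N x y) (h' : T.SameCode N y z) :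
    T.SameCode N x z :=
  fun k hk i => (h k hk i).trans (h' k hk i)

theorem isClopenSet_of_sameCode (i₀ : Fin n) (N : ℕ) {S : Set ℝ}
    (hS : ∀ x ∈ S, ∀ y, T.SameCode N x y → y ∈ S) : T.IsClopenSet S :=
  IsClopenSet.of_saturated (ι := Fin N × Fin n) i₀
    (A := fun p => T.toFun^[p.1] ⁻¹' T.interval p.2)
    (fun p => (IsClopenSet.interval p.2).iterate _)
    fun x hx y h => hS x hx y fun k hk i => h (⟨k, hk⟩, i)

theorem start_nonneg {l : Fin n → ℝ} (hl : ∀ i, 0 < l i) (i : Fin n) : 0 ≤ start l i :=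
  Finset.sum_nonneg fun j _ => (hl j).le

theorem start_add_le {l : Fin n → ℝ} (hl : ∀ i, 0 < l i) (i : Fin n) :
    start l i + l i ≤ ∑ j, l j := by
  rw [start, add_comm, ← Finset.sum_insert (by simp)]
  exact Finset.sum_le_univ_sum_of_nonneg fun j => (hl j).le

theorem toFun_mem_Icc (T : IntervalExchange n) (x : ℝ) : T.toFun x ∈ Set.Icc (0 : ℝ) 1 := by
  by_cases h : ∃ i, x ∈ T.interval i
  · obtain ⟨i, hi⟩ := h
    have h0 : 0 ≤ T.imageLeft i := start_nonneg (fun k => T.len_pos _) (T.perm i)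
    have h1 : T.imageLeft i + T.len i ≤ 1 := by
      have := start_add_le (fun k => T.inverse.len_pos k) (T.perm i)
      rw [T.inverse.sum_len] at this
      simpa [imageLeft, inverse] using! this
    rw [T.toFun_eq i hi, piece]
    have := hi.1
    have := hi.2
    split_ifs
    · constructor <;> linarith
    · constructor <;> linarith
  · rw [toFun, Finset.sum_eq_zero fun i _ => if_neg fun hi => h ⟨i, hi⟩]
    simp

theorem exists_mem_interval (T : IntervalExchange n) {x : ℝ} (hx : x ∈ Set.Ico (0 : ℝ) 1) :
    ∃ i, x ∈ T.interval i := by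
  rwa [← T.iUnion_interval, Set.mem_iUnion] at hx

/-- The points with a given code of finite length form an interval. -/
theorem SameCode.of_mem_Icc {N : ℕ} {x y t : ℝ} (hx : x ∈ Set.Ico (0 : ℝ) 1)
    (hy : y ∈ Set.Ico (0 : ℝ) 1) (h : T.SameCode N x y) (ht : t ∈ Set.Icc x y) :
    T.SameCode N x t := by
  obtain rfl | hxy := (ht.1.trans ht.2).eq_or_lt
  · obtain rfl := le_antisymm ht.1 ht.2
    exact h
  -- While the `k`-th iterate is a single isometry on `[x, y]`, the image is the segment between the
  -- images of `x` and `y`. These lie in the same exchanged interval, which is convex and so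
  -- contains the whole image.
  have step : ∀ k < N, ∀ a : ℝ, (a = 1 ∨ a = -1) →
      (∀ z ∈ Set.Icc x y, T.toFun^[k] z = T.toFun^[k] x + a * (z - x)) →
      ∃ i, ∀ z ∈ Set.Icc x y, T.toFun^[k] z ∈ T.interval i := by
    intro k hk a ha hz
    have hy' := hz y ⟨hxy.le, le_rfl⟩
    have hex : ∃ i, T.toFun^[k] x ∈ T.interval i := by
      by_contra hne
      -- By the convention for flips a left endpoint can be sent to `1`, which lies in no interval.
      -- This is the only way for an orbit to leave the intervals, and it cannot happen to `x` and
      -- `y` at the same time, as an isometry keeps them apart.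
      have hone : ∀ w ∈ Set.Ico (0 : ℝ) 1, (¬ ∃ i, T.toFun^[k] w ∈ T.interval i) →
          T.toFun^[k] w = 1 := by
        intro w hw hwn
        have hI : T.toFun^[k] w ∈ Set.Icc (0 : ℝ) 1 := by
          cases k with
          | zero => exact ⟨hw.1, hw.2.le⟩
          | succ k => rw [Function.iterate_succ_apply']; exact T.toFun_mem_Icc _
        by_contra h1
        exact hwn (T.exists_mem_interval ⟨hI.1, lt_of_le_of_ne hI.2 h1⟩)
      rw [hone x hx hne, hone y hy fun ⟨i, hi⟩ => hne ⟨i, (h k hk i).2 hi⟩] at hy'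
      rcases ha with rfl | rfl <;> linarith
    obtain ⟨i, hi⟩ := hex
    have hi' := (h k hk i).1 hi
    refine ⟨i, fun z hzm => ?_⟩
    rw [hz z hzm]
    rw [hy'] at hi'
    rcases ha with rfl | rfl
    · exact ⟨by linarith [hi.1, hzm.1], by linarith [hi'.2, hzm.2]⟩
    · exact ⟨by linarith [hi'.1, hzm.2], by linarith [hi.2, hzm.1]⟩
  have aff : ∀ k ≤ N, ∃ a : ℝ, (a = 1 ∨ a = -1) ∧
      ∀ z ∈ Set.Icc x y, T.toFun^[k] z = T.toFun^[k] x + a * (z - x) := by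
    intro k
    induction k with
    | zero => exact fun _ => ⟨1, Or.inl rfl, fun z _ => by simp⟩
    | succ k ih =>
      intro hk
      obtain ⟨a, ha, hz⟩ := ih (by omega)
      obtain ⟨i, hi⟩ := step k (by omega) a ha hz
      have hix := hi x ⟨le_rfl, hxy.le⟩
      by_cases hs : T.sign i = 1
      · refine ⟨a, ha, fun z hzm => ?_⟩
        rw [Function.iterate_succ_apply', Function.iterate_succ_apply', T.toFun_eq i (hi z hzm),
          T.toFun_eq i hix, piece, piece, if_pos hs, if_pos hs, hz z hzm]
        ring
      · refine ⟨-a, by rcases ha with rfl | rfl <;> simp, fun z hzm => ?_⟩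
        rw [Function.iterate_succ_apply', Function.iterate_succ_apply', T.toFun_eq i (hi z hzm),
          T.toFun_eq i hix, piece, piece, if_neg hs, if_neg hs, hz z hzm]
        ring
  intro k hk j
  obtain ⟨a, ha, hz⟩ := aff k hk.le
  obtain ⟨i, hi⟩ := step k hk a ha hz
  have hix := hi x ⟨le_rfl, hxy.le⟩
  have hit := hi t ht
  by_cases hij : i = j
  · subst hij
    exact iff_of_true hix hit
  · have hd := Set.disjoint_left.1 (T.disjoint_interval hij)
    exact iff_of_false (hd hix) (hd hit)

/-- The sets decrease to the cell of the full itinerary of `t`, which is null. -/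
theorem IsStationary.tendsto_lebesgue_sameCode (hn : 2 ≤ n) (hT : T.IsStationary) (t : ℝ) :
    Tendsto (fun N => lebesgue {y | T.SameCode N t y}) atTop (𝓝 0) := by
  have hi₀ : Fin n := ⟨0, by omega⟩
  have hmeas : ∀ N, MeasurableSet {y | T.SameCode N t y} := fun N =>
    (isClopenSet_of_sameCode hi₀ N fun x hx y h => SameCode.trans hx h).measurableSet
  have h := tendsto_measure_iInter_atTop (μ := lebesgue)
    (s := fun N => {y | T.SameCode N t y}) (fun N => (hmeas N).nullMeasurableSet)
    (fun N M hNM y hy k hk => hy k (hk.trans_le hNM)) ⟨0, measure_ne_top _ _⟩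
  have hcell : (⋂ N, {y | T.SameCode N t y}) =
      T.cell fun k i => T.toFun^[k] t ∈ T.interval i := by
    ext y
    rw [Set.mem_iInter]
    exact ⟨fun hy k i => (hy (k + 1) k k.lt_succ_self i).symm,
      fun hy N k _ i => (hy k i).symm⟩
  rwa [hcell, hT.lebesgue_cell hn] at h

/-- Within `[0, 1)`, the half-line consists of the set `B` of points left of `t` with a code
different from that of `t`, and a part of the cell `C` of `t`. Both `B` and `C` are clopen, so `μ`
and `ν` agree on `B`, and the error is at most `lebesgue C`, which tends to zero with growing `N`.
-/
theorem IsStationary.measure_Iio_le (hn : 2 ≤ n) (hT : T.IsStationary) {μ ν : Measure ℝ}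
    [IsProbabilityMeasure μ] [IsProbabilityMeasure ν] (hμ : T.IsInvariant μ)
    (hν : T.IsInvariant ν) (t : ℝ) :
    μ (Set.Iio t) ≤ ν (Set.Iio t) := by
  have hi₀ : Fin n := ⟨0, by omega⟩
  have hlim := (tendsto_const_nhds (x := ν (Set.Iio t))).add
    (hT.tendsto_lebesgue_sameCode hn t)
  rw [add_zero] at hlim
  refine ge_of_tendsto hlim ?_
  -- A code of positive length records whether the point lies in `[0, 1)`.
  filter_upwards [eventually_gt_atTop 0] with N hN
  let C : Set ℝ := {y | T.SameCode N t y}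
  let B : Set ℝ := {y | y ∈ Set.Ico (0 : ℝ) 1 ∧ y < t ∧ ¬ T.SameCode N t y}
  have hC : T.IsClopenSet C := isClopenSet_of_sameCode hi₀ N fun x hx y h => SameCode.trans hx h
  have hB : T.IsClopenSet B := by
    refine isClopenSet_of_sameCode hi₀ N fun x hx y h => ?_
    have hy : y ∈ Set.Ico (0 : ℝ) 1 := by
      obtain ⟨i, hi⟩ := T.exists_mem_interval hx.1
      exact T.interval_subset i ((h 0 hN i).1 hi)
    refine ⟨hy, ?_, fun h' => hx.2.2 (h'.trans h.symm)⟩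
    -- Otherwise `t` would lie between two points with the same code and would share it.
    by_contra hty
    exact hx.2.2 (h.of_mem_Icc hx.1 hy ⟨hx.2.1.le, not_lt.1 hty⟩).symm
  have hsub : Set.Iio t ⊆ B ∪ C ∪ (Set.Ico 0 1)ᶜ := by
    intro y hy
    by_cases h1 : y ∈ Set.Ico (0 : ℝ) 1
    · by_cases h2 : T.SameCode N t y
      · exact Or.inl (Or.inr h2)
      · exact Or.inl (Or.inl ⟨h1, hy, h2⟩)
    · exact Or.inr h1
  calc μ (Set.Iio t) ≤ μ B + μ C + μ (Set.Ico 0 1)ᶜ :=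
        (measure_mono hsub).trans ((measure_union_le _ _).trans
          (add_le_add_left (measure_union_le _ _) _))
    _ = ν B + lebesgue C := by
        rw [hμ.carrier, add_zero, hT.measure_eq hμ hB, hT.measure_eq hμ hC, hT.measure_eq hν hB]
    _ ≤ ν (Set.Iio t) + lebesgue C :=
        add_le_add_left (measure_mono fun y hy => hy.2.1) _

theorem IsStationary.invariant_unique (hn : 2 ≤ n) (hT : T.IsStationary) {μ ν : Measure ℝ}
    [IsProbabilityMeasure μ] [IsProbabilityMeasure ν] (hμ : T.IsInvariant μ)
    (hν : T.IsInvariant ν) : μ = ν := by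
  refine Measure.ext_of_Ici μ ν fun t => ?_
  rw [← Set.compl_Iio, prob_compl_eq_one_sub measurableSet_Iio,
    prob_compl_eq_one_sub measurableSet_Iio,
    le_antisymm (hT.measure_Iio_le hn hμ hν t) (hT.measure_Iio_le hn hν hμ t)]

end IntervalExchange

theorem theorem2 {n : ℕ} (hn : 2 ≤ n) (T : IntervalExchange n) (hT : T.IsStationary) :
    T.StrictlyErgodic := by
  refine ⟨IntervalExchange.lebesgue, ⟨inferInstance, T.isInvariant_lebesgue⟩, ?_⟩
  rintro μ ⟨_, hμ⟩
  exact hT.invariant_unique hn hμ T.isInvariant_lebesgue
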